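/- **Theorem 2.3.** Let $\zeta$ be a real transcendental number. For $n\ge 1$ let $w_n(\zeta)\in[-\infty,\infty]$ be the supremum of the real numbers $w$ such that $0<|P(\zeta)|\le H(P)^{-w}$ has infinitely many solutions $P\in\mathbb Z[T]$ of degree at most $n$, where $H(P)$ is the maximum of the absolute values of the coefficients of $P$. Let $\lambda_n(\zeta)\in[-\infty,\infty]$ be the supremum of the real numbers $\lambda$ such that the system $$1\le |x|\le X,\qquad \max_{1\le i\le n}|\zeta^i x-y_i|\le X^{-\lambda}$$ has a solution $(x,y_1,\dots,y_n)\in\mathbb Z^{n+1}$ for arbitrarily large real $X$. Put $$\overline w=\limsup_{n\to\infty}\frac{w_n(\zeta)}{n},\quad \underline w=\liminf_{n\to\infty}\frac{w_n(\zeta)}{n},\quad \overline\lambda=\limsup_{n\to\infty} n\lambda_n(\zeta),\quad \underline\lambda=\liminf_{n\to\infty} n\lambda_n(\zeta),$$ $$\tau(\zeta)=\limsup_{n\to\infty}\frac{\log w_n(\zeta)}{\log n},\qquad \sigma(\zeta)=\limsup_{n\to\infty}\frac{\log\lambda_n(\zeta)}{\log n},$$ with values in $[-\infty,\infty]$ and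 the conventions $\log\infty=\infty$ and $1/\infty=0$; the expression $(t+1)^2/(4t)$ is read as its limit $\infty$ at $t=\infty$. Then $$\frac{(\overline w+1)^2}{4\overline w}\le\overline\lambda\le\overline w+2,\qquad \frac{(\underline w+1)^2}{4\underline w}\le\underline\lambda\le\underline w+2.$$ If moreover $\zeta$ is not a Liouville number (equivalently, if $w_1(\zeta)<\infty$), then $$\sigma(\zeta)=-\frac{1}{\tau(\zeta)}.$$ -/

import Mathlib

open Filter

noncomputable section

namespace MahlerExp

/-- The exponent `w_n(ζ)` of polynomial approximation: the supremum, in `[-∞, ∞]`, of the real `w`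
such that `0 < |P(ζ)| ≤ H(P)^{-w}` for infinitely many integer polynomials `P` of degree at most
`n`. The height `H(P)`, the maximum of the absolute values of the coefficients, is `P.supNorm`. -/
def w (n : ℕ) (ζ : ℝ) : EReal :=
  ⨆ (w : ℝ) (_ : {P : Polynomial ℤ | P.natDegree ≤ n ∧ 0 < |Polynomial.aeval ζ P| ∧
    |Polynomial.aeval ζ P| ≤ P.supNorm ^ (-w)}.Infinite), (w : EReal)

/-- The exponent `λ_n(ζ)` of simultaneous rational approximation to `(ζ, ζ², …, ζⁿ)`: the supremum,
in `[-∞, ∞]`, of the real `l` such that for arbitrarily large real `X` there are integers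
`x, y_1, …, y_n` with `1 ≤ |x| ≤ X` and `|ζ^i x - y_i| ≤ X^{-l}` for `1 ≤ i ≤ n`
(the coordinate `y_i` is `y (i - 1)` below). -/
def lam (n : ℕ) (ζ : ℝ) : EReal :=
  ⨆ (l : ℝ) (_ : ∃ᶠ X : ℝ in atTop, ∃ (x : ℤ) (y : Fin n → ℤ),
    1 ≤ |x| ∧ ((|x| : ℤ) : ℝ) ≤ X ∧
      ∀ i : Fin n, |ζ ^ ((i : ℕ) + 1) * (x : ℝ) - (y i : ℝ)| ≤ X ^ (-l)), (l : EReal)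

/-- The logarithm on `[0, ∞]`, with `log 0 = -∞` and `log ∞ = ∞`. (Both exponents above are
positive for `n ≥ 1` and transcendental `ζ`.) -/
def elog (x : EReal) : EReal := ENNReal.log x.toENNReal

/-- `limsup w_n(ζ) / n`. -/
def wSup (ζ : ℝ) : EReal := limsup (fun n : ℕ => w n ζ / (n : EReal)) atTop

/-- `liminf w_n(ζ) / n`. -/
def wInf (ζ : ℝ) : EReal := liminf (fun n : ℕ => w n ζ / (n : EReal)) atTop

/-- `limsup n λ_n(ζ)`. -/
def lamSup (ζ : ℝ) : EReal := limsup (fun n : ℕ => (n : EReal) * lam n ζ) atTop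

/-- `liminf n λ_n(ζ)`. -/
def lamInf (ζ : ℝ) : EReal := liminf (fun n : ℕ => (n : EReal) * lam n ζ) atTop

/-- The order `τ(ζ) = limsup log w_n(ζ) / log n`. -/
def tau (ζ : ℝ) : EReal :=
  limsup (fun n : ℕ => elog (w n ζ) / (Real.log n : EReal)) atTop

/-- The dual order `σ(ζ) = limsup log λ_n(ζ) / log n`. -/
def sigma (ζ : ℝ) : EReal :=
  limsup (fun n : ℕ => elog (lam n ζ) / (Real.log n : EReal)) atTop

/-- The function `(t + 1)² / (4 t)` on `[1, ∞]`, with its limit value `∞` at `t = ∞`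
(where the `EReal` quotient `⊤ / ⊤` would be `0`). -/
def lowerBound (t : EReal) : EReal :=
  if t = ⊤ then ⊤ else (t + 1) ^ 2 / (4 * t)

end MahlerExp

end

/-!
Both inequalities rest on transference statements between a single degree `n` for polynomials and a
single dimension `N` for simultaneous approximation; the limits and orders are then elementary.

*Lower bound* (`le_lam_of_lt_w`). If `|P ζ| ≤ H ^ (-t)` with `P` of degree at most `n` and height
`H`, then for every `n ≤ N < n + t`
`λ_N ≥ (n + t - N) / ((n - 1) t + N)`.
Look for integers `z_0, …, z_N` satisfying the linear recurrence with coefficients those of `P`. The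
progression `ζ ^ i` almost satisfies it, because `P ζ` is almost zero. The `N - n + 1` relations
together with `n` coordinate conditions form `N + 1` linear forms, and Minkowski's theorem makes the
relations, being integers of absolute value `< 1`, hold exactly. The recurrence then propagates
closeness to a geometric progression from the last `n` coordinates to all of them, provided that its
lowest coefficient is as large as the height. That is arranged by first translating the variable by
an integer `m ≤ n` with `|P m|` comparable to `H`. With `n ~ N / s` and `w_n ~ t n` this gives
`N λ_N ≥ s (1 + t - s) / t` in the limit, and `s = (1 + t) / 2` is optimal.

*Upper bound* (`lam_le_one_div`). If `N ≥ 2 n - 1 + w_n` (with `w_n` slightly enlarged), then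
`λ_N ≤ 1 / n`. Suppose `(x_0, …, x_N)` is a better approximation, and let `L` be the functional
`T ^ i ↦ x_i`. On polynomials of moderate height that are small enough at `ζ`, `L` takes integer
values of absolute value `< 1`, so it vanishes. Dirichlet's theorem supplies such a `Q` of
degree at most `n`, and an even smaller `P` of degree at most `N + 1 - n`. Split `P = A B` with `B`
coprime to `Q` and `A` a product of divisors of `Q`. As the Mahler measure is multiplicative, the
definition of `w_n` bounds `|A ζ|` from below as if `A` were a single polynomial of degree at most
`n`, so that `B ζ` is still small. Now `L` kills all multiples of `B` and `Q` of degree at most `N`, hence their nonzero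
resultant, so `x_0 = 0`, which is absurd.

For the orders, `N ~ w_n / 2` in the lower bound and `n ~ (N / 4) ^ (1 / u)`, `u > τ`, in the upper
bound give `σ = -1 / τ` when `1 < τ < ∞`; when `τ = 1`, the general estimate `λ_N ≥ 1 / (2 N)`
replaces the former. When `τ = ∞` the upper estimate `σ ≤ 0` comes from `λ_N ≤ λ_1 < ∞`, and this is
where `ζ` must not be a Liouville number.
-/

namespace MahlerExp

section Transference

open Polynomial

/-! ### Linear forms and small values of polynomials -/

/-- **Minkowski's theorem on linear forms**, with all inequalities strict. -/
theorem exists_int_abs_mulVec_lt {ι : Type*} [Fintype ι] [DecidableEq ι] (A : Matrix ι ι ℝ)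
    (hA : A.det ≠ 0) (c : ι → ℝ) (hc : ∀ i, 0 < c i) (h : |A.det| < ∏ i, c i) :
    ∃ z : ι → ℤ, z ≠ 0 ∧ ∀ i, |A.mulVec (fun j => (z j : ℝ)) i| < c i := by
  classical
  set S : Set (ι → ℝ) := Set.univ.pi fun i => Set.Ioo (-c i) (c i) with hS
  set s : Set (ι → ℝ) := (Matrix.toLin' A) ⁻¹' S with hs
  have hdet : LinearMap.det (Matrix.toLin' A) ≠ 0 := by rwa [LinearMap.det_toLin']
  have hvol : MeasureTheory.volume s = ENNReal.ofReal |(A.det)⁻¹| *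
      ENNReal.ofReal (∏ i, (2 * c i)) := by
    rw [hs, MeasureTheory.Measure.addHaar_preimage_linearMap _ hdet, LinearMap.det_toLin', hS,
      Real.volume_pi_Ioo, ← ENNReal.ofReal_prod_of_nonneg (fun i _ => by linarith [hc i])]
    congr 3
    ext i
    ring
  have hF : MeasureTheory.volume (ZSpan.fundamentalDomain (Pi.basisFun ℝ ι)) = 1 := by
    rw [ZSpan.fundamentalDomain_pi_basisFun, MeasureTheory.volume_pi, MeasureTheory.Measure.pi_pi]
    simp
  have hlt : MeasureTheory.volume (ZSpan.fundamentalDomain (Pi.basisFun ℝ ι)) *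
      2 ^ Module.finrank ℝ (ι → ℝ) < MeasureTheory.volume s := by
    rw [hvol, hF, one_mul, Module.finrank_pi, ← ENNReal.ofReal_mul (abs_nonneg _),
      Finset.prod_mul_distrib, Finset.prod_const, Finset.card_univ]
    have h2 : (2 : ENNReal) ^ Fintype.card ι = ENNReal.ofReal (2 ^ Fintype.card ι) := by
      rw [ENNReal.ofReal_pow (by norm_num)]; simp
    have hpos : 0 < |A.det| := abs_pos.2 hA
    rw [h2, abs_inv, ENNReal.ofReal_lt_ofReal_iff_of_nonneg (by positivity),
      inv_mul_eq_div, lt_div_iff₀ hpos]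
    exact mul_lt_mul_of_pos_left h (by positivity)
  have : Countable (Submodule.span ℤ (Set.range (Pi.basisFun ℝ ι))).toAddSubgroup :=
    inferInstanceAs (Countable (Submodule.span ℤ (Set.range (Pi.basisFun ℝ ι))))
  obtain ⟨⟨x, hx⟩, hx0, hxs⟩ :=
    MeasureTheory.exists_ne_zero_mem_lattice_of_measure_mul_two_pow_lt_measure
      (ZSpan.isAddFundamentalDomain' (Pi.basisFun ℝ ι) MeasureTheory.volume) (s := s)
      (by
        intro x hx
        simp only [hs, hS, Set.mem_preimage, Set.mem_univ_pi, Set.mem_Ioo, map_neg,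
          Pi.neg_apply] at hx ⊢
        exact fun i => ⟨by linarith [(hx i).2], by linarith [(hx i).1]⟩)
      ((convex_pi fun i _ => convex_Ioo _ _).linear_preimage (Matrix.toLin' A)) hlt
  have hx' : x ∈ Submodule.span ℤ (Set.range (Pi.basisFun ℝ ι)) := hx
  rw [Module.Basis.mem_span_iff_repr_mem] at hx'
  choose z hz using hx'
  have hzx : (fun j => (z j : ℝ)) = x := by
    ext j
    simpa using hz j
  refine ⟨z, ?_, fun i => ?_⟩
  · rintro rfl
    apply hx0
    ext j
    simpa using (congrFun hzx j).symm
  · rw [hzx, abs_lt]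
    simp only [hs, hS, Set.mem_preimage, Set.mem_univ_pi, Set.mem_Ioo, Matrix.toLin'_apply] at hxs
    exact hxs i

/-! ### Heights of integer polynomials and Dirichlet's theorem -/

theorem aeval_eq_sum_fin {n : ℕ} (ζ : ℝ) {P : ℤ[X]} (hP : P.natDegree ≤ n) :
    aeval ζ P = ∑ i : Fin (n + 1), (P.coeff i : ℝ) * ζ ^ (i : ℕ) := by
  rw [aeval_eq_sum_range' (Nat.lt_succ_of_le hP), Finset.sum_range]
  simp

theorem one_le_supNorm {P : ℤ[X]} (hP : P ≠ 0) : 1 ≤ P.supNorm := by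
  refine le_trans ?_ (P.le_supNorm P.natDegree)
  rw [Int.norm_eq_abs]
  exact_mod_cast Int.one_le_abs (leadingCoeff_ne_zero.2 hP)

theorem abs_coeff_le_supNorm (P : ℤ[X]) (i : ℕ) : |(P.coeff i : ℝ)| ≤ P.supNorm := by
  simpa [Int.norm_eq_abs] using P.le_supNorm i

theorem supNorm_le_of_coeff {P : ℤ[X]} {B : ℝ} (h : ∀ i, |(P.coeff i : ℝ)| ≤ B) :
    P.supNorm ≤ B := by
  obtain ⟨i, hi⟩ := P.exists_eq_supNorm
  rw [hi, Int.norm_eq_abs]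
  exact h i

/-- Dirichlet's theorem: small values of integer polynomials of degree at most `n` at `ζ`. -/
theorem exists_poly_abs_aeval_le (ζ : ℝ) (n : ℕ) : ∃ C : ℝ, 0 < C ∧ ∀ H : ℝ, 1 ≤ H →
    ∃ P : ℤ[X], P ≠ 0 ∧ P.natDegree ≤ n ∧ P.supNorm ≤ C * H ∧ |aeval ζ P| ≤ C * (H ^ n)⁻¹ := by
  refine ⟨2 + ∑ i : Fin (n + 1), |ζ| ^ (i : ℕ), by positivity, fun H hH => ?_⟩
  have hH0 : 0 < H := by linarith
  -- The forms are the value at `ζ` and the coefficients of positive degree; the constant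
  -- coefficient is then controlled by the others.
  set A : Matrix (Fin (n + 1)) (Fin (n + 1)) ℝ :=
    Matrix.of fun i j => if i = 0 then ζ ^ (j : ℕ) else if i = j then 1 else 0 with hA
  have hdet : A.det = 1 := by
    rw [Matrix.det_of_isUpperTriangular]
    · refine Finset.prod_eq_one fun i _ => ?_
      by_cases hi : i = 0 <;> simp [hA, hi]
    · intro i j hij
      have h0 : i ≠ 0 := fun h => by simp [h] at hij
      have h1 : i ≠ j := fun h => by simp [h] at hij
      simp [hA, h0, h1]
  obtain ⟨z, hz0, hz⟩ := exists_int_abs_mulVec_lt A (by rw [hdet]; norm_num)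
    (Fin.cons (2 * (H ^ n)⁻¹) fun _ => H)
    (by
      intro i
      refine Fin.cases ?_ (fun i => ?_) i
      · simp only [Fin.cons_zero]; positivity
      · simpa using hH0)
    (by
      rw [Fin.prod_univ_succ, hdet]
      simp only [Fin.cons_zero, Fin.cons_succ, Finset.prod_const, Finset.card_univ,
        Fintype.card_fin]
      rw [mul_assoc, inv_mul_cancel₀ (by positivity)]
      norm_num)
  have hz1 : ∀ i : Fin n, |(z i.succ : ℝ)| < H := by
    intro i
    have := hz i.succ
    simpa [Matrix.mulVec, dotProduct, hA] using this
  have hz2 : |∑ i, (z i : ℝ) * ζ ^ (i : ℕ)| < 2 * (H ^ n)⁻¹ := by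
    have := hz 0
    simpa [Matrix.mulVec, dotProduct, hA, mul_comm] using this
  have hsum : 0 ≤ ∑ i : Fin (n + 1), |ζ| ^ (i : ℕ) := by positivity
  have hdeg : (ofFn (n + 1) z).natDegree ≤ n := Nat.lt_succ_iff.1 (ofFn_natDegree_lt (by simp) z)
  have hcoeff : ∀ i : Fin (n + 1), (ofFn (n + 1) z).coeff i = z i := fun i => by
    rw [ofFn_coeff_eq_val_of_lt _ i.2]
  refine ⟨ofFn (n + 1) z, ?_, hdeg, ?_, ?_⟩
  · intro h
    apply hz0
    ext i
    rw [← hcoeff i, h]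
    simp
  · apply supNorm_le_of_coeff
    intro i
    have key : ∀ i : Fin (n + 1), |(z i : ℝ)| ≤
        (2 + ∑ i : Fin (n + 1), |ζ| ^ (i : ℕ)) * H := by
      intro i
      refine Fin.cases ?_ (fun i => ?_) i
      · have h1 : (z 0 : ℝ) = ∑ i, (z i : ℝ) * ζ ^ (i : ℕ) -
            ∑ i : Fin n, (z i.succ : ℝ) * ζ ^ ((i : ℕ) + 1) := by
          rw [Fin.sum_univ_succ]; simp
        have h2 : |∑ i : Fin n, (z i.succ : ℝ) * ζ ^ ((i : ℕ) + 1)| ≤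
            ∑ i : Fin n, H * |ζ| ^ ((i : ℕ) + 1) := by
          refine (Finset.abs_sum_le_sum_abs _ _).trans (Finset.sum_le_sum fun i _ => ?_)
          rw [abs_mul, abs_pow]
          gcongr
          exact (hz1 i).le
        have h3 : 2 * (H ^ n)⁻¹ ≤ 2 * H := by
          have : (H ^ n)⁻¹ ≤ 1 := inv_le_one_of_one_le₀ (one_le_pow₀ hH)
          linarith
        rw [h1]
        refine (abs_sub _ _).trans ?_
        have h4 : ∑ i : Fin (n + 1), |ζ| ^ (i : ℕ) = 1 + ∑ i : Fin n, |ζ| ^ ((i : ℕ) + 1) := by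
          rw [Fin.sum_univ_succ]; simp
        rw [h4]
        rw [← Finset.mul_sum] at h2
        nlinarith
      · nlinarith [hz1 i]
    by_cases hi : i < n + 1
    · have := hcoeff ⟨i, hi⟩
      simp only at this
      rw [this]
      exact key _
    · rw [ofFn_coeff_eq_zero_of_ge _ (by omega)]
      simp only [Int.cast_zero, abs_zero]
      positivity
  · rw [aeval_eq_sum_fin ζ hdeg]
    simp only [hcoeff]
    refine hz2.le.trans ?_
    gcongr
    linarith

theorem supNorm_map_intCast (P : ℤ[X]) : (P.map (Int.castRingHom ℂ)).supNorm = P.supNorm := by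
  refine (isGreatest_supNorm _).unique ?_
  have := isGreatest_supNorm P
  have h : (fun i => ‖(P.map (Int.castRingHom ℂ)).coeff i‖) = fun i => ‖P.coeff i‖ := by
    ext i
    simp [Int.norm_eq_abs]
  rwa [h]

theorem finite_supNorm_le (n : ℕ) (B : ℝ) :
    {P : ℤ[X] | P.natDegree ≤ n ∧ P.supNorm ≤ B}.Finite := by
  rcases lt_or_ge B 0 with hB | hB
  · convert Set.finite_empty
    ext P
    simp only [Set.mem_ofPred_eq, Set.mem_empty_iff_false, iff_false, not_and, not_le]
    exact fun _ => hB.trans_le P.supNorm_nonneg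
  · refine (finite_mahlerMeasure_le n ⟨√(n + 1) * B, by positivity⟩).subset ?_
    rintro P ⟨h1, h2⟩
    refine ⟨h1, (mahlerMeasure_le_sqrt_natDegree_add_one_mul_supNorm _).trans ?_⟩
    rw [supNorm_map_intCast]
    have : (P.map (Int.castRingHom ℂ)).natDegree ≤ n := natDegree_map_le.trans h1
    show _ ≤ √(n + 1) * B
    gcongr
    exact P.supNorm_nonneg

theorem aeval_ne_zero {ζ : ℝ} (hζ : Transcendental ℚ ζ) {P : ℤ[X]} (hP : P ≠ 0) :
    aeval ζ P ≠ 0 :=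
  fun h => hζ ((IsFractionRing.isAlgebraic_iff ℤ ℚ ℝ).1 ⟨P, hP, h⟩)

/-! ### The exponent `w_n` -/

/-- Below `w_n`, the approximating polynomials exist with arbitrarily large height, since there are
only finitely many of bounded height. -/
theorem exists_poly_of_lt_w {n : ℕ} {ζ t : ℝ} (h : (t : EReal) < w n ζ) (B : ℝ) :
    ∃ P : ℤ[X], P.natDegree ≤ n ∧ 0 < |aeval ζ P| ∧ |aeval ζ P| ≤ P.supNorm ^ (-t) ∧
      B ≤ P.supNorm := by
  simp only [w, lt_iSup_iff] at h
  obtain ⟨t', hinf, htt'⟩ := h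
  obtain ⟨P, ⟨h1, h2, h3⟩, hP⟩ := (hinf.sdiff (finite_supNorm_le n B)).nonempty
  have hP0 : P ≠ 0 := by
    rintro rfl
    simp at h2
  refine ⟨P, h1, h2, h3.trans ?_, ?_⟩
  · exact Real.rpow_le_rpow_of_exponent_le (one_le_supNorm hP0)
      (neg_le_neg (EReal.coe_lt_coe_iff.1 htt').le)
  · by_contra hB
    exact hP ⟨h1, (not_le.1 hB).le⟩

/-- Above `w_n`, only finitely many polynomials violate the lower bound, and a constant takes
care of them because `ζ` is transcendental. -/
theorem exists_lower_bound_of_w_lt {n : ℕ} {ζ t : ℝ} (hζ : Transcendental ℚ ζ)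
    (h : w n ζ < (t : EReal)) : ∃ c : ℝ, 0 < c ∧ c ≤ 1 ∧ ∀ P : ℤ[X], P ≠ 0 → P.natDegree ≤ n →
      c * P.supNorm ^ (-t) ≤ |aeval ζ P| := by
  set S := {P : ℤ[X] | P.natDegree ≤ n ∧ 0 < |aeval ζ P| ∧ |aeval ζ P| ≤ P.supNorm ^ (-t)}
  have hfin : S.Finite := by
    by_contra hinf
    exact absurd (le_iSup₂_of_le (f := fun (w : ℝ) (_ : {P : ℤ[X] | P.natDegree ≤ n ∧
      0 < |aeval ζ P| ∧ |aeval ζ P| ≤ P.supNorm ^ (-w)}.Infinite) => (w : EReal)) t hinf le_rfl)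
      (not_le.2 h)
  have key : ∃ c : ℝ, 0 < c ∧ ∀ P ∈ S, c * P.supNorm ^ (-t) ≤ |aeval ζ P| := by
    rcases S.eq_empty_or_nonempty with hS | hS
    · exact ⟨1, one_pos, by simp [hS]⟩
    · obtain ⟨P, hP, hmin⟩ := Set.exists_min_image S
        (fun P => |aeval ζ P| / P.supNorm ^ (-t)) hfin hS
      have hpos : ∀ P ∈ S, 0 < P.supNorm ^ (-t) := fun P hP => hP.2.1.trans_le hP.2.2
      refine ⟨_, div_pos hP.2.1 (hpos P hP), fun Q hQ => ?_⟩
      exact (le_div_iff₀ (hpos Q hQ)).1 (hmin Q hQ)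
  obtain ⟨c, hc, hcS⟩ := key
  refine ⟨min c 1, by positivity, min_le_right _ _, fun P hP hdeg => ?_⟩
  have h0 : 0 ≤ P.supNorm ^ (-t) := Real.rpow_nonneg P.supNorm_nonneg _
  rcases le_or_gt |aeval ζ P| (P.supNorm ^ (-t)) with hle | hgt
  · refine le_trans ?_ (hcS P ⟨hdeg, abs_pos.2 (aeval_ne_zero hζ hP), hle⟩)
    gcongr
    exact min_le_left _ _
  · refine le_trans ?_ hgt.le
    exact mul_le_of_le_one_left h0 (min_le_right _ _)

/-- Dirichlet's theorem in terms of the exponent: `w_n ≥ n`. -/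
theorem le_w {ζ : ℝ} (hζ : Transcendental ℚ ζ) {n : ℕ} (hn : 1 ≤ n) : (n : EReal) ≤ w n ζ := by
  refine le_of_forall_lt fun a ha => ?_
  by_contra! hcon
  obtain ⟨t, hat, htn⟩ := EReal.exists_between_coe_real ha
  obtain ⟨c, hc, -, hlow⟩ := exists_lower_bound_of_w_lt hζ (hcon.trans_lt hat)
  have htn' : t < n := by exact_mod_cast htn
  obtain ⟨C, hC, hD⟩ := exists_poly_abs_aeval_le ζ n
  -- Replacing `t` by its positive part makes `x ↦ x ^ (-u)` antitone.
  set u := max t 0 with hu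
  have hun : u < n := max_lt htn' (by exact_mod_cast hn)
  have hbd : ∀ H : ℝ, 1 ≤ H → H ^ ((n : ℝ) - u) ≤ C * (C ^ u / c) := by
    intro H hH
    have hH0 : 0 < H := by linarith
    obtain ⟨P, hP0, hPd, hPH, hPζ⟩ := hD H hH
    have h1 := (hlow P hP0 hPd).trans hPζ
    have hs := one_le_supNorm hP0
    have h2 : (C * H) ^ (-u) ≤ P.supNorm ^ (-t) := by
      calc (C * H) ^ (-u) ≤ P.supNorm ^ (-u) :=
            Real.rpow_le_rpow_of_nonpos (by linarith) hPH (by simp [hu])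
        _ ≤ _ := Real.rpow_le_rpow_of_exponent_le hs (neg_le_neg (le_max_left _ _))
    have h3 : c * (C * H) ^ (-u) ≤ C * (H ^ n)⁻¹ := le_trans (by gcongr) h1
    rw [Real.mul_rpow hC.le hH0.le, Real.rpow_neg hC.le, Real.rpow_neg hH0.le] at h3
    rw [Real.rpow_sub hH0, Real.rpow_natCast]
    have hCu : 0 < C ^ u := by positivity
    have hHu : 0 < H ^ u := by positivity
    have hHn : 0 < H ^ n := by positivity
    field_simp at h3 ⊢
    linarith
  have htend := tendsto_rpow_atTop (sub_pos.2 hun)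
  obtain ⟨H, hH1, hH2⟩ := ((eventually_ge_atTop (1 : ℝ)).and
    (htend.eventually_gt_atTop (C * (C ^ u / c)))).exists
  exact absurd (hbd H hH1) (not_le.2 hH2)

/-! ### Mahler measure of integer polynomials -/

/-- The Mahler measure of an integer polynomial. -/
noncomputable def intMahler (P : ℤ[X]) : ℝ := (P.map (Int.castRingHom ℂ)).mahlerMeasure

theorem intMahler_mul (P Q : ℤ[X]) : intMahler (P * Q) = intMahler P * intMahler Q := by
  simp [intMahler, mahlerMeasure_mul]

theorem one_le_intMahler {P : ℤ[X]} (hP : P ≠ 0) : 1 ≤ intMahler P :=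
  one_le_mahlerMeasure_of_ne_zero hP

theorem intMahler_le {n : ℕ} {P : ℤ[X]} (hP : P.natDegree ≤ n) :
    intMahler P ≤ √(n + 1) * P.supNorm := by
  refine (mahlerMeasure_le_sqrt_natDegree_add_one_mul_supNorm _).trans ?_
  rw [supNorm_map_intCast]
  have : (P.map (Int.castRingHom ℂ)).natDegree ≤ n := natDegree_map_le.trans hP
  gcongr
  exact P.supNorm_nonneg

theorem supNorm_le_two_pow_mul_intMahler {n : ℕ} {P : ℤ[X]} (hP : P.natDegree ≤ n) :
    P.supNorm ≤ 2 ^ n * intMahler P := by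
  rw [← supNorm_map_intCast]
  refine (supNorm_le_choose_natDegree_div_two_mul_mahlerMeasure _).trans ?_
  have h : (P.map (Int.castRingHom ℂ)).natDegree ≤ n := natDegree_map_le.trans hP
  have h2 := (Nat.choose_le_two_pow (P.map (Int.castRingHom ℂ)).natDegree
    ((P.map (Int.castRingHom ℂ)).natDegree / 2)).trans (Nat.pow_le_pow_right (by norm_num) h)
  have h3 : (((P.map (Int.castRingHom ℂ)).natDegree.choose
    ((P.map (Int.castRingHom ℂ)).natDegree / 2) : ℕ) : ℝ) ≤ 2 ^ n := by exact_mod_cast h2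
  exact mul_le_mul_of_nonneg_right h3 (mahlerMeasure_nonneg _)

/-! ### Splitting off common factors -/

/-- Integer polynomials that are not coprime over `ℚ` have a nonconstant common factor over `ℤ`
(Gauss's lemma). -/
theorem exists_common_factor {P Q : ℤ[X]} (hQ : Q ≠ 0)
    (h : ¬ IsCoprime (P.map (algebraMap ℤ ℚ)) (Q.map (algebraMap ℤ ℚ))) :
    ∃ G : ℤ[X], 1 ≤ G.natDegree ∧ G ∣ P ∧ G ∣ Q := by
  classical
  have hinj : Function.Injective (algebraMap ℤ ℚ) := (algebraMap ℤ ℚ).injective_int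
  set g := EuclideanDomain.gcd (P.map (algebraMap ℤ ℚ)) (Q.map (algebraMap ℤ ℚ)) with hg
  have hgu : ¬ IsUnit g := fun hu => h (EuclideanDomain.gcd_isUnit_iff.1 hu)
  have hg0 : g ≠ 0 := fun h0 => by
    have := (EuclideanDomain.gcd_eq_zero_iff.1 h0).2
    exact hQ ((Polynomial.map_eq_zero_iff hinj).1 this)
  obtain ⟨b, hbM, hb⟩ := IsLocalization.integerNormalization_spec (nonZeroDivisors ℤ) g
  set f := IsLocalization.integerNormalization (nonZeroDivisors ℤ) g with hf
  have hb0 : (b : ℚ) ≠ 0 := by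
    exact_mod_cast nonZeroDivisors.ne_zero hbM
  have hfC : f.map (algebraMap ℤ ℚ) = C (b : ℚ) * g := by
    rw [hb]
    ext i
    simp [Algebra.smul_def]
  have hcont : f.map (algebraMap ℤ ℚ) =
      C ((f.content : ℤ) : ℚ) * f.primPart.map (algebraMap ℤ ℚ) := by
    conv_lhs => rw [f.eq_C_content_mul_primPart]
    simp
  have hf0 : f ≠ 0 := by
    intro h0
    rw [h0, Polynomial.map_zero] at hfC
    have : C (b : ℚ) * g ≠ 0 := mul_ne_zero (C_ne_zero.2 hb0) hg0
    exact this hfC.symm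
  have hc0 : ((f.content : ℤ) : ℚ) ≠ 0 := by
    exact_mod_cast fun h0 => hf0 (content_eq_zero_iff.1 h0)
  have hdeg : f.primPart.natDegree = g.natDegree := by
    rw [natDegree_primPart, ← natDegree_map_eq_of_injective hinj f, hfC, natDegree_C_mul hb0]
  have hdvd : f.primPart.map (algebraMap ℤ ℚ) ∣ g := by
    have h1 : f.primPart.map (algebraMap ℤ ℚ) ∣ C (b : ℚ) * g := by
      rw [← hfC, hcont]
      exact dvd_mul_left _ _
    exact (dvd_C_mul hb0).1 h1
  refine ⟨f.primPart, ?_, ?_, ?_⟩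
  · rw [hdeg]
    by_contra hlt
    have h0 : g.natDegree = 0 := by omega
    rw [natDegree_eq_zero] at h0
    obtain ⟨a, ha⟩ := h0
    apply hgu
    rw [← ha, isUnit_C, isUnit_iff_ne_zero]
    rintro rfl
    exact hg0 (by rw [← ha, C_0])
  · rw [f.isPrimitive_primPart.dvd_iff_fraction_map_dvd_fraction_map ℚ]
    exact hdvd.trans (EuclideanDomain.gcd_dvd_left _ _)
  · rw [f.isPrimitive_primPart.dvd_iff_fraction_map_dvd_fraction_map ℚ]
    exact hdvd.trans (EuclideanDomain.gcd_dvd_right _ _)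

/-- Split off from `P` all factors shared with `Q`. If polynomials of degree at most `n` are never
too small at `ζ` in terms of their Mahler measure, then neither is the part split off, since the
Mahler measure is multiplicative. -/
theorem exists_coprime_split {ζ c W : ℝ} {n : ℕ} (hc : 0 < c) (hc1 : c ≤ 1)
    (hlow : ∀ R : ℤ[X], R ≠ 0 → R.natDegree ≤ n → c * intMahler R ^ (-W) ≤ |aeval ζ R|)
    {Q : ℤ[X]} (hQ : Q ≠ 0) (hQn : Q.natDegree ≤ n) (P : ℤ[X]) (hP : P ≠ 0) :
    ∃ A B : ℤ[X], P = A * B ∧ IsCoprime (B.map (algebraMap ℤ ℚ)) (Q.map (algebraMap ℤ ℚ)) ∧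
      c ^ A.natDegree * intMahler A ^ (-W) ≤ |aeval ζ A| := by
  induction hd : P.natDegree using Nat.strong_induction_on generalizing P with
  | _ d ih =>
    by_cases hcop : IsCoprime (P.map (algebraMap ℤ ℚ)) (Q.map (algebraMap ℤ ℚ))
    · refine ⟨1, P, by simp, hcop, ?_⟩
      simp [intMahler]
    · obtain ⟨G, hG1, ⟨P', hP'⟩, hGQ⟩ := exists_common_factor hQ hcop
      have hG0 : G ≠ 0 := by rintro rfl; simp at hG1
      have hP'0 : P' ≠ 0 := by rintro rfl; simp at hP'; exact hP hP'
      have hdeg : P.natDegree = G.natDegree + P'.natDegree := by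
        rw [hP', natDegree_mul hG0 hP'0]
      obtain ⟨A, B, hAB, hB, hA⟩ := ih P'.natDegree (by omega) P' hP'0 rfl
      have hA0 : A ≠ 0 := by rintro rfl; simp at hAB; exact hP'0 hAB
      refine ⟨G * A, B, by rw [hP', hAB, mul_assoc], hB, ?_⟩
      have hG := hlow G hG0 ((natDegree_le_of_dvd hGQ hQ).trans hQn)
      have hmG := one_le_intMahler hG0
      have hmA := one_le_intMahler hA0
      rw [map_mul, abs_mul, intMahler_mul, Real.mul_rpow (by linarith) (by linarith),
        natDegree_mul hG0 hA0, pow_add]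
      calc c ^ G.natDegree * c ^ A.natDegree * (intMahler G ^ (-W) * intMahler A ^ (-W))
          = (c ^ G.natDegree * intMahler G ^ (-W)) * (c ^ A.natDegree * intMahler A ^ (-W)) := by
            ring
        _ ≤ (c * intMahler G ^ (-W)) * (c ^ A.natDegree * intMahler A ^ (-W)) := by
            gcongr
            exact pow_le_of_le_one hc.le hc1 (by omega)
        _ ≤ _ := by gcongr

/-! ### Functionals attached to integer points -/

/-- The linear functional on polynomials of degree at most `N` sending `X ^ i` to `x i`. -/
noncomputable def evalSeq (N : ℕ) (x : ℕ → ℤ) : ℤ[X] →ₗ[ℤ] ℤ :=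
  ∑ i ∈ Finset.range (N + 1), x i • lcoeff ℤ i

theorem evalSeq_apply (N : ℕ) (x : ℕ → ℤ) (F : ℤ[X]) :
    evalSeq N x F = ∑ i ∈ Finset.range (N + 1), x i * F.coeff i := by
  simp [evalSeq]

theorem evalSeq_one (N : ℕ) (x : ℕ → ℤ) : evalSeq N x 1 = x 0 := by
  rw [evalSeq_apply, Finset.sum_eq_single 0]
  · simp
  · intro i _ hi
    simp [coeff_one, hi]
  · simp

/-- If `(x 0, …, x N)` is close to `x 0 • (1, ζ, …, ζ ^ N)` and `F ζ` is small, then the integer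
`evalSeq N x F` vanishes. -/
theorem evalSeq_eq_zero {N : ℕ} {x : ℕ → ℤ} {F : ℤ[X]} {ζ Y ε : ℝ} (hF : F.natDegree ≤ N)
    (hx0 : |(x 0 : ℝ)| ≤ Y) (hx : ∀ i ≤ N, |ζ ^ i * x 0 - x i| ≤ ε)
    (hsmall : Y * |aeval ζ F| + (N + 1) * (F.supNorm * ε) < 1) : evalSeq N x F = 0 := by
  rw [← Int.abs_lt_one_iff]
  have h : ((evalSeq N x F : ℤ) : ℝ) = x 0 * aeval ζ F -
      ∑ i ∈ Finset.range (N + 1), (F.coeff i : ℝ) * (ζ ^ i * x 0 - x i) := by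
    rw [evalSeq_apply, aeval_eq_sum_range' (Nat.lt_succ_of_le hF), Finset.mul_sum,
      ← Finset.sum_sub_distrib]
    push_cast
    refine Finset.sum_congr rfl fun i _ => ?_
    simp only [zsmul_eq_mul]
    ring
  have h2 : |∑ i ∈ Finset.range (N + 1), (F.coeff i : ℝ) * (ζ ^ i * x 0 - x i)| ≤
      (N + 1) * (F.supNorm * ε) := by
    refine (Finset.abs_sum_le_sum_abs _ _).trans ?_
    have : ∀ i ∈ Finset.range (N + 1), |(F.coeff i : ℝ) * (ζ ^ i * x 0 - x i)| ≤
        F.supNorm * ε := by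
      intro i hi
      rw [abs_mul]
      exact mul_le_mul (abs_coeff_le_supNorm F i) (hx i (by simpa [Nat.lt_succ_iff] using hi))
        (abs_nonneg _) F.supNorm_nonneg
    refine (Finset.sum_le_card_nsmul _ _ _ this).trans ?_
    simp
  have h3 : |((evalSeq N x F : ℤ) : ℝ)| < 1 := by
    rw [h]
    refine (abs_sub _ _).trans_lt (lt_of_le_of_lt (add_le_add ?_ h2) hsmall)
    rw [abs_mul]
    gcongr
  exact_mod_cast h3

theorem supNorm_X_pow_mul_le (j : ℕ) (F : ℤ[X]) : (X ^ j * F).supNorm ≤ F.supNorm := by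
  apply supNorm_le_of_coeff
  intro i
  rw [coeff_X_pow_mul']
  split_ifs
  · exact abs_coeff_le_supNorm F _
  · simpa using F.supNorm_nonneg

/-- A functional that kills the multiples of `B` and `Q` of degree at most `N` kills their
resultant. -/
theorem apply_one_eq_zero_of_isCoprime {L : ℤ[X] →ₗ[ℤ] ℤ} {B Q : ℤ[X]} {b q : ℕ}
    (hB0 : B ≠ 0)
    (hcop : IsCoprime (B.map (algebraMap ℤ ℚ)) (Q.map (algebraMap ℤ ℚ)))
    (hB : B.natDegree ≤ b) (hQ : Q.natDegree ≤ q) (hq : 1 ≤ q)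
    (hLB : ∀ j < q, L (X ^ j * B) = 0) (hLQ : ∀ j < b, L (X ^ j * Q) = 0) : L 1 = 0 := by
  have hinj : Function.Injective (algebraMap ℤ ℚ) := (algebraMap ℤ ℚ).injective_int
  have hC : ∀ a : ℤ, L (C a) = a * L 1 := fun a => by
    rw [← mul_one (C a), ← smul_eq_C_mul, map_smul, smul_eq_mul]
  have hmul : ∀ (F G : ℤ[X]) (k : ℕ), F.degree < k → (∀ j < k, L (X ^ j * G) = 0) →
      L (G * F) = 0 := by
    intro F G k hF hG
    rcases eq_or_ne F 0 with rfl | h0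
    · simp
    have hsum : G * F = ∑ j ∈ Finset.range k, F.coeff j • (X ^ j * G) := by
      conv_lhs => rw [F.as_sum_range' k ((natDegree_lt_iff_degree_lt h0).2 hF), Finset.mul_sum]
      refine Finset.sum_congr rfl fun j _ => ?_
      rw [← C_mul_X_pow_eq_monomial, smul_eq_C_mul]
      ring
    rw [hsum, map_sum]
    refine Finset.sum_eq_zero fun j hj => ?_
    rw [map_smul, hG j (Finset.mem_range.1 hj), smul_zero]
  by_cases hdeg : B.natDegree = 0 ∧ Q.natDegree = 0
  · obtain ⟨a, ha⟩ := natDegree_eq_zero.1 hdeg.1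
    have h1 := hLB 0 (by omega)
    rw [pow_zero, one_mul, ← ha, hC] at h1
    rcases mul_eq_zero.1 h1 with h | h
    · exact absurd (by rw [← ha, h, C_0]) hB0
    · exact h
  · obtain ⟨u, v, hu, hv, huv⟩ := exists_mul_add_mul_eq_C_resultant B Q le_rfl le_rfl (by omega)
    have hres : resultant B Q ≠ 0 := by
      intro h0
      have h1 := resultant_map_map B Q B.natDegree Q.natDegree (algebraMap ℤ ℚ)
      rw [h0, map_zero] at h1
      have h2 : resultant (B.map (algebraMap ℤ ℚ)) (Q.map (algebraMap ℤ ℚ)) = 0 := by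
        rw [natDegree_map_eq_of_injective hinj, natDegree_map_eq_of_injective hinj]
        exact h1
      exact (resultant_eq_zero_iff.1 h2).2 hcop
    have h3 : L (C (resultant B Q)) = 0 := by
      rw [← huv, map_add,
        hmul u B _ hu fun j hj => hLB j (by omega),
        hmul v Q _ hv fun j hj => hLQ j (by omega), add_zero]
    rw [hC] at h3
    exact (mul_eq_zero.1 h3).resolve_left hres

/-! ### Upper bound for simultaneous approximation -/

/-- The lower bound for polynomial values in terms of the multiplicative Mahler measure. -/
theorem exists_intMahler_lower_bound {n : ℕ} {ζ W : ℝ} (hζ : Transcendental ℚ ζ)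
    (hW0 : 0 ≤ W) (hW : w n ζ < (W : EReal)) : ∃ c : ℝ, 0 < c ∧ c ≤ 1 ∧
      ∀ R : ℤ[X], R ≠ 0 → R.natDegree ≤ n → c * intMahler R ^ (-W) ≤ |aeval ζ R| := by
  obtain ⟨c, hc, hc1, h⟩ := exists_lower_bound_of_w_lt hζ hW
  have h2 : (0 : ℝ) < (2 ^ n) ^ (-W) := by positivity
  have h3 : ((2 : ℝ) ^ n) ^ (-W) ≤ 1 :=
    Real.rpow_le_one_of_one_le_of_nonpos (one_le_pow₀ (by norm_num)) (by linarith)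
  refine ⟨c * (2 ^ n) ^ (-W), by positivity, mul_le_one₀ hc1 h2.le h3, fun R hR hdeg => ?_⟩
  refine le_trans ?_ (h R hR hdeg)
  have hm := one_le_intMahler hR
  rw [mul_assoc, ← Real.mul_rpow (show (0 : ℝ) ≤ 2 ^ n by positivity) (zero_le_one.trans hm)]
  gcongr ?_ * ?_
  exact Real.rpow_le_rpow_of_nonpos (zero_lt_one.trans_le (one_le_supNorm hR))
    (supNorm_le_two_pow_mul_intMahler hdeg) (neg_nonpos.2 hW0)

/-- The coprime part of a very small polynomial is still small: the part of `P` shared with `Q`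
cannot account for more than `H ^ (-W)`. -/
theorem exists_small_coprime_pair {n M : ℕ} {ζ W : ℝ} (hζ : Transcendental ℚ ζ)
    (hW0 : 0 ≤ W) (hW : w n ζ < (W : EReal)) : ∃ C : ℝ, 0 < C ∧ ∀ H : ℝ, 1 ≤ H →
      ∃ B Q : ℤ[X], B ≠ 0 ∧ B.natDegree ≤ M ∧ Q.natDegree ≤ n ∧
        IsCoprime (B.map (algebraMap ℤ ℚ)) (Q.map (algebraMap ℤ ℚ)) ∧
        B.supNorm ≤ C * H ∧ Q.supNorm ≤ C * H ∧ |aeval ζ Q| ≤ C * H ^ (-(n : ℝ)) ∧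
        |aeval ζ B| ≤ C * H ^ (W - M) := by
  obtain ⟨c, hc, hc1, hlow⟩ := exists_intMahler_lower_bound hζ hW0 hW
  obtain ⟨C₁, hC₁, hQ⟩ := exists_poly_abs_aeval_le ζ n
  obtain ⟨C₂, hC₂, hP⟩ := exists_poly_abs_aeval_le ζ M
  set K : ℝ := √(M + 1) * C₂ with hK
  have hKpos : 0 < K := by positivity
  refine ⟨C₁ + 2 ^ M * K + C₂ * K ^ W / c ^ M, by positivity, fun H hH => ?_⟩
  have hH0 : 0 < H := by linarith
  have hT : 0 < C₂ * K ^ W / c ^ M := by positivity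
  have hT2 : 0 < 2 ^ M * K := by positivity
  obtain ⟨Q, hQ0, hQn, hQH, hQζ⟩ := hQ H hH
  obtain ⟨P, hP0, hPM, hPH, hPζ⟩ := hP H hH
  obtain ⟨A, B, hAB, hcop, hA⟩ := exists_coprime_split hc hc1 hlow hQ0 hQn P hP0
  have hA0 : A ≠ 0 := by rintro rfl; simp at hAB; exact hP0 hAB
  have hB0 : B ≠ 0 := by rintro rfl; simp at hAB; exact hP0 hAB
  have hdeg : P.natDegree = A.natDegree + B.natDegree := by rw [hAB, natDegree_mul hA0 hB0]
  have hmP : intMahler A * intMahler B ≤ K * H := by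
    rw [← intMahler_mul, ← hAB]
    refine (intMahler_le hPM).trans ?_
    rw [hK, mul_assoc]
    gcongr
  have hmA := one_le_intMahler hA0
  have hmB := one_le_intMahler hB0
  have hmA' : intMahler A ≤ K * H := by nlinarith
  have hmB' : intMahler B ≤ K * H := by nlinarith
  have hlowA : c ^ M * (K * H) ^ (-W) ≤ |aeval ζ A| := by
    refine le_trans ?_ hA
    gcongr ?_ * ?_
    · exact pow_le_pow_of_le_one hc.le hc1 (by omega)
    · exact Real.rpow_le_rpow_of_nonpos (by linarith) hmA' (by linarith)
  refine ⟨B, Q, hB0, by omega, hQn, hcop, ?_, ?_, ?_, ?_⟩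
  · refine (supNorm_le_two_pow_mul_intMahler (n := M) (by omega)).trans ?_
    calc 2 ^ M * intMahler B ≤ 2 ^ M * (K * H) := by gcongr
      _ = (2 ^ M * K) * H := by ring
      _ ≤ _ := by gcongr; linarith
  · refine hQH.trans ?_
    gcongr
    linarith
  · rw [Real.rpow_neg hH0.le, Real.rpow_natCast]
    refine hQζ.trans ?_
    gcongr
    linarith
  · have h1 : c ^ M * (K * H) ^ (-W) * |aeval ζ B| ≤ C₂ * (H ^ M)⁻¹ := by
      refine le_trans ?_ hPζ
      rw [hAB, map_mul, abs_mul]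
      gcongr
    rw [Real.rpow_neg (by positivity), Real.mul_rpow hKpos.le hH0.le] at h1
    rw [Real.rpow_sub hH0, Real.rpow_natCast]
    have hKW : 0 < K ^ W := by positivity
    have hHW : 0 < H ^ W := by positivity
    have h2 : |aeval ζ B| ≤ C₂ * K ^ W / c ^ M * (H ^ W / H ^ M) := by
      rw [div_mul_div_comm, le_div_iff₀ (by positivity)]
      field_simp at h1
      linarith
    refine h2.trans ?_
    gcongr
    linarith

/-- The transference upper bound: an approximation `(x, y)` of quality `l` to
`(ζ, …, ζ ^ N)` annihilates all multiples of degree at most `N` of a polynomial of degree at most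
`n` and of a coprime one of degree at most `N + 1 - n`, which is impossible. -/
theorem lam_le_of_w_lt {n N : ℕ} {ζ W l : ℝ} (hζ : Transcendental ℚ ζ) (hn : 1 ≤ n) (hnN : n ≤ N)
    (hW0 : 0 ≤ W) (hW : w n ζ < (W : EReal)) (h1 : 1 < l * n) (h2 : 1 < l * (N + 1 - n - W)) :
    lam N ζ ≤ (l : EReal) := by
  have hn0 : (0 : ℝ) < n := by exact_mod_cast hn
  have hl0 : 0 < l := by
    by_contra h
    nlinarith
  have hD : 0 < (N : ℝ) + 1 - n - W := by
    by_contra h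
    nlinarith
  -- Heights up to `Y ^ m` with `m` slightly below `l` leave room for the constants.
  obtain ⟨m, hm, hml⟩ : ∃ m, max (1 / (n : ℝ)) (1 / ((N : ℝ) + 1 - n - W)) < m ∧ m < l :=
    exists_between (max_lt ((div_lt_iff₀ hn0).2 h1) ((div_lt_iff₀ hD).2 h2))
  have hm1 : 1 < m * n := (div_lt_iff₀ hn0).1 ((le_max_left _ _).trans_lt hm)
  have hm2 : 1 < m * (N + 1 - n - W) := (div_lt_iff₀ hD).1 ((le_max_right _ _).trans_lt hm)
  have hm0 : 0 < m := by
    by_contra h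
    nlinarith
  by_contra! hlt
  simp only [lam, lt_iSup_iff] at hlt
  obtain ⟨l', hfreq, hll'⟩ := hlt
  have hll : l < l' := by exact_mod_cast hll'
  obtain ⟨C, hC, hpair⟩ := exists_small_coprime_pair (M := N + 1 - n) hζ hW0 hW
  set Z : ℝ := (1 + |ζ|) ^ N with hZ
  have hZpos : 0 < Z := by positivity
  have hZj : ∀ j ≤ N, |ζ ^ j| ≤ Z := by
    intro j hj
    rw [abs_pow]
    calc |ζ| ^ j ≤ (1 + |ζ|) ^ j := by gcongr; linarith
      _ ≤ _ := pow_le_pow_right₀ (by linarith [abs_nonneg ζ]) hj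
  have hcast : ((N + 1 - n : ℕ) : ℝ) = N + 1 - n := by
    rw [Nat.cast_sub (by omega)]; push_cast; ring
  have ht0 : Tendsto (fun X : ℝ => Z * C * X ^ (-(m * n - 1)) + (N + 1) * C * X ^ (-(l' - m)))
      atTop (nhds 0) := by
    have ha := (tendsto_rpow_neg_atTop (sub_pos.2 hm1)).const_mul (Z * C)
    have hb := (tendsto_rpow_neg_atTop (sub_pos.2 (hml.trans hll))).const_mul (((N : ℝ) + 1) * C)
    simpa using ha.add hb
  have ht1 : Tendsto (fun X : ℝ => Z * C * X ^ (-(m * (N + 1 - n - W) - 1)) +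
      (N + 1) * C * X ^ (-(l' - m))) atTop (nhds 0) := by
    have ha := (tendsto_rpow_neg_atTop (sub_pos.2 hm2)).const_mul (Z * C)
    have hb := (tendsto_rpow_neg_atTop (sub_pos.2 (hml.trans hll))).const_mul (((N : ℝ) + 1) * C)
    simpa using ha.add hb
  obtain ⟨Y, ⟨x, y, hx1, hxY, hxy⟩, hY1, hYQ, hYB⟩ := (hfreq.and_eventually
    ((eventually_ge_atTop (1 : ℝ)).and ((ht0.eventually_lt_const one_pos).and
      (ht1.eventually_lt_const one_pos)))).exists
  have hY0 : 0 < Y := by linarith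
  obtain ⟨B, Q, hB0, hBd, hQd, hcop, hBs, hQs, hQζ, hBζ⟩ := hpair (Y ^ m)
    (Real.one_le_rpow hY1 hm0.le)
  -- The integer point `(x, y 0, …, y (N - 1))`, indexed so that `s i` approximates `ζ ^ i * s 0`.
  set s : ℕ → ℤ := fun i => if i = 0 then x else if h : i - 1 < N then y ⟨i - 1, h⟩ else 0
    with hs
  have hs0 : s 0 = x := by simp [hs]
  have hsY : |(s 0 : ℝ)| ≤ Y := by rw [hs0]; exact_mod_cast hxY
  have hsx : ∀ i ≤ N, |ζ ^ i * s 0 - s i| ≤ Y ^ (-l') := by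
    intro i hi
    rcases Nat.eq_zero_or_pos i with rfl | hi0
    · simp only [pow_zero, one_mul, sub_self, abs_zero]
      positivity
    · have h := hxy ⟨i - 1, by omega⟩
      have hi' : i - 1 < N := by omega
      have hsi : s i = y ⟨i - 1, hi'⟩ := by
        simp only [hs]
        rw [if_neg (by omega), dif_pos hi']
      rw [hs0, hsi]
      simpa [Nat.sub_add_cancel hi0] using h
  have hkill : ∀ (F : ℤ[X]) (e : ℝ) (j : ℕ), j + F.natDegree ≤ N → F.supNorm ≤ C * Y ^ m →
      |aeval ζ F| ≤ C * (Y ^ m) ^ e →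
      Z * C * Y ^ (-(m * (-e) - 1)) + (N + 1) * C * Y ^ (-(l' - m)) < 1 →
      evalSeq N s (X ^ j * F) = 0 := by
    intro F e j hdeg hFs hFζ hlt
    have hY : Y * Y ^ (m * e) = Y ^ (-(m * (-e) - 1)) := by
      nth_rewrite 1 [← Real.rpow_one Y]
      rw [← Real.rpow_add hY0]
      congr 1
      ring
    have hY' : Y ^ m * Y ^ (-l') = Y ^ (-(l' - m)) := by
      rw [← Real.rpow_add hY0]
      congr 1
      ring
    refine evalSeq_eq_zero (natDegree_mul_le.trans ?_) hsY hsx (lt_of_le_of_lt ?_ hlt)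
    · rw [natDegree_X_pow]; exact hdeg
    · rw [map_mul, map_pow, aeval_X, abs_mul]
      rw [← Real.rpow_mul hY0.le] at hFζ
      calc Y * (|ζ ^ j| * |aeval ζ F|) + (N + 1) * ((X ^ j * F).supNorm * Y ^ (-l'))
          ≤ Y * (Z * (C * Y ^ (m * e))) + (N + 1) * ((C * Y ^ m) * Y ^ (-l')) := by
            gcongr
            · exact hZj j (by omega)
            · exact (supNorm_X_pow_mul_le j F).trans hFs
        _ = Z * C * (Y * Y ^ (m * e)) + (N + 1) * C * (Y ^ m * Y ^ (-l')) := by ring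
        _ = _ := by rw [hY, hY']
  have hL1 : evalSeq N s 1 = 0 := by
    refine apply_one_eq_zero_of_isCoprime hB0 hcop hBd hQd hn (fun j hj => ?_) fun j hj => ?_
    · refine hkill B _ j (by omega) hBs hBζ ?_
      rw [hcast, show -(W - ((N : ℝ) + 1 - n)) = N + 1 - n - W by ring]
      exact hYB
    · refine hkill Q _ j (by omega) hQs hQζ ?_
      rw [neg_neg]
      exact hYQ
  rw [evalSeq_one, hs0] at hL1
  rw [hL1] at hx1
  simp at hx1

/-- The upper bound in its balanced form, where both polynomials allow the exponent `1 / n`. -/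
theorem lam_le_one_div {n N : ℕ} {ζ W : ℝ} (hζ : Transcendental ℚ ζ) (hn : 1 ≤ n)
    (hW : w n ζ < (W : EReal)) (hN : 2 * n - 1 + W ≤ N) :
    lam N ζ ≤ ((1 / n : ℝ) : EReal) := by
  have hn0 : (1 : ℝ) ≤ n := by exact_mod_cast hn
  have hW0 : (n : ℝ) < W := by exact_mod_cast (le_w hζ hn).trans_lt hW
  have hnN : (n : ℝ) ≤ N := by linarith
  refine EReal.le_of_forall_lt_iff_le.1 fun l hl => ?_
  have hl' : 1 / (n : ℝ) < l := by exact_mod_cast hl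
  have h1 : 1 < l * n := (div_lt_iff₀ (by linarith)).1 hl'
  have hl0 : 0 < l := lt_trans (by positivity) hl'
  refine lam_le_of_w_lt hζ hn (by exact_mod_cast hnN) (by linarith) hW h1 ?_
  have : l * n ≤ l * (N + 1 - n - W) := by
    gcongr
    linarith
  linarith

/-! ### Integer recurrences close to a geometric progression -/

/-- Backward induction along a linear recurrence: if the tail of `v` is bounded by `δ` and each
earlier term is controlled by the next `n` ones, then all terms are `O(δ)`. -/
theorem abs_le_of_backward_recurrence {N r n : ℕ} {v : ℕ → ℝ} {D K δ : ℝ}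
    (hn : 1 ≤ n) (hrN : r + n = N + 1) (hD : 0 ≤ D) (hK : 0 ≤ K) (hδ : 0 < δ)
    (htail : ∀ i, r ≤ i → i ≤ N → |v i| ≤ δ)
    (hrec : ∀ i < r, |v i| ≤ D * δ + K * ∑ k ∈ Finset.range n, |v (i + k + 1)|) :
    ∀ i ≤ N, |v i| ≤ (1 + D + K * n) ^ N * δ := by
  set E := 1 + D + K * n with hE
  have hE1 : 1 ≤ E := by
    have : 0 ≤ K * n := by positivity
    linarith
  have key : ∀ j ≤ N, |v (N - j)| ≤ E ^ j * δ := by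
    intro j
    induction j using Nat.strong_induction_on with
    | _ j ih =>
      intro hj
      rcases le_or_gt r (N - j) with hr | hr
      · refine (htail _ hr (Nat.sub_le _ _)).trans ?_
        exact le_mul_of_one_le_left hδ.le (one_le_pow₀ hE1)
      · have hn : n ≤ j := by omega
        have hj0 : 0 < j := by omega
        have hsum : ∑ k ∈ Finset.range n, |v (N - j + k + 1)| ≤ n * (E ^ (j - 1) * δ) := by
          rw [← nsmul_eq_mul]
          refine (Finset.sum_le_card_nsmul _ _ (E ^ (j - 1) * δ) fun k hk => ?_).trans
            (by rw [Finset.card_range])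
          have hk' := Finset.mem_range.1 hk
          have h1 := ih (j - (k + 1)) (by omega) (by omega)
          rw [show N - (j - (k + 1)) = N - j + k + 1 by omega] at h1
          exact h1.trans (mul_le_mul_of_nonneg_right
            (pow_le_pow_right₀ hE1 (by omega)) hδ.le)
        refine (hrec _ hr).trans ?_
        have hp : 1 ≤ E ^ (j - 1) := one_le_pow₀ hE1
        have hj' : E ^ j = E * E ^ (j - 1) := by
          rw [← pow_succ', Nat.sub_add_cancel hj0]
        calc D * δ + K * ∑ k ∈ Finset.range n, |v (N - j + k + 1)|
            ≤ D * (E ^ (j - 1) * δ) + K * (n * (E ^ (j - 1) * δ)) := by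
              gcongr
              exact le_mul_of_one_le_left hδ.le hp
          _ = (D + K * n) * (E ^ (j - 1) * δ) := by ring
          _ ≤ E * (E ^ (j - 1) * δ) := by
              gcongr
              linarith
          _ = E ^ j * δ := by rw [hj']; ring
  intro i hi
  have := key (N - i) (by omega)
  rw [Nat.sub_sub_self hi] at this
  exact this.trans (mul_le_mul_of_nonneg_right (pow_le_pow_right₀ hE1 (Nat.sub_le _ _)) hδ.le)

/-- The linear forms used to produce integer solutions of the linear recurrence with coefficients
those of `B` that are close to a geometric progression of ratio `ξ`: the recurrence relations
themselves (rows `< r`), and the distance to the progression ending in the last coordinate. -/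
noncomputable def recurrenceMatrix (N r : ℕ) (ξ : ℝ) (B : ℤ[X]) :
    Matrix (Fin (N + 1)) (Fin (N + 1)) ℝ :=
  Matrix.of fun i j =>
    if (i : ℕ) < r then if i ≤ j then (B.coeff (j - i) : ℝ) else 0
    else if j = i then 1 else if j = Fin.last N then -(ξ ^ (i : ℕ) / ξ ^ N) else 0

theorem recurrenceMatrix_apply (N r : ℕ) (ξ : ℝ) (B : ℤ[X]) (i j : Fin (N + 1)) :
    recurrenceMatrix N r ξ B i j =
      if (i : ℕ) < r then if i ≤ j then (B.coeff (j - i) : ℝ) else 0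
      else if j = i then 1 else if j = Fin.last N then -(ξ ^ (i : ℕ) / ξ ^ N) else 0 :=
  rfl

theorem det_recurrenceMatrix {r k : ℕ} (ξ : ℝ) (B : ℤ[X]) :
    (recurrenceMatrix (r + k) r ξ B).det = (B.coeff 0 : ℝ) ^ r := by
  rw [Matrix.det_of_isUpperTriangular]
  · have : ∀ i : Fin (r + k + 1), recurrenceMatrix (r + k) r ξ B i i =
        (fun i : ℕ => if i < r then (B.coeff 0 : ℝ) else 1) i := by
      intro i
      simp [recurrenceMatrix_apply]
    rw [Finset.prod_congr rfl fun i _ => this i,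
      Fin.prod_univ_eq_prod_range (fun i : ℕ => if i < r then (B.coeff 0 : ℝ) else 1),
      add_assoc, Finset.prod_range_add, Finset.prod_congr rfl (g := fun _ => (B.coeff 0 : ℝ)),
      Finset.prod_congr (s₁ := Finset.range (k + 1)) rfl (g := fun _ => (1 : ℝ))]
    · simp
    · intro i _
      simp
    · intro i hi
      simp [Finset.mem_range.1 hi]
  · intro i j hij
    have hij' : j < i := hij
    have h1 : ¬ i ≤ j := not_le.2 hij'
    have h2 : j ≠ i := hij'.ne
    have h3 : j ≠ Fin.last (r + k) := (hij'.trans_le (Fin.le_last i)).ne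
    simp [recurrenceMatrix_apply, h1, h2, h3]

/-- If the constant coefficient of `B` dominates the others and `B ξ` is small, then the recurrence
with coefficients those of `B` has a nonzero integer solution close to a geometric progression of
ratio `ξ`. The relation imposed on `δ` is what makes the box of Minkowski's theorem large enough
while balancing the error `δ` against the effect of `B ξ ≠ 0`. -/
theorem exists_recurrence_near_geometric {r k : ℕ} (hr : 1 ≤ r) {ξ : ℝ} (hξ : ξ ≠ 0)
    {K : ℝ} (hK : 0 ≤ K) :
    ∃ C : ℝ, 0 < C ∧ ∀ B : ℤ[X], B.natDegree ≤ k + 1 → B.coeff 0 ≠ 0 →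
      (∀ i, |(B.coeff i : ℝ)| ≤ K * |(B.coeff 0 : ℝ)|) → ∀ p : ℝ, 0 < p → |aeval ξ B| ≤ p →
      ∀ δ : ℝ, 0 < δ → δ ^ (k + 1) = 2 * |(B.coeff 0 : ℝ)| ^ (r - 1) * p →
      ∃ z : ℕ → ℤ, (∃ i ≤ r + k, z i ≠ 0) ∧
        |(z 0 : ℝ)| ≤ C * (δ * |(B.coeff 0 : ℝ)| / p + δ) ∧
        ∀ i ≤ r + k, |(z i : ℝ) - ξ ^ i * z 0| ≤ C * δ := by
  set N := r + k with hN
  set D : ℝ := (1 + |ξ|) ^ N / |ξ| ^ N with hD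
  have hξ0 : 0 < |ξ| := abs_pos.2 hξ
  have hD0 : 0 < D := by positivity
  set E : ℝ := (1 + D + K * (k + 1 : ℕ)) ^ N with hE
  have hE0 : 0 < E := by positivity
  refine ⟨E * (1 + (1 + |ξ|) ^ N) + 1 / |ξ| ^ N, by positivity,
    fun B hB hB0 hBK p hp hBp δ hδ hδp => ?_⟩
  have hb0 : (B.coeff 0 : ℝ) ≠ 0 := by exact_mod_cast hB0
  have hb : 0 < |(B.coeff 0 : ℝ)| := abs_pos.2 hb0
  set Y := δ * |(B.coeff 0 : ℝ)| / p with hY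
  have hY0 : 0 < Y := by positivity
  obtain ⟨z', hz'0, hz'⟩ := exists_int_abs_mulVec_lt (recurrenceMatrix N r ξ B)
    (by rw [det_recurrenceMatrix]; exact pow_ne_zero _ hb0)
    (fun i => (fun i : ℕ => if i < r then 1 else if i < N then δ else Y) i)
    (by
      intro i
      dsimp only
      split_ifs <;> positivity)
    (by
      rw [det_recurrenceMatrix,
        Fin.prod_univ_eq_prod_range (fun i : ℕ => if i < r then 1 else if i < N then δ else Y),
        Finset.prod_range_succ, hN, Finset.prod_range_add,
        Finset.prod_congr rfl (g := fun _ => (1 : ℝ)),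
        Finset.prod_congr (s₁ := Finset.range k) rfl (g := fun _ => δ)]
      · simp only [Finset.prod_const_one, one_mul, Finset.prod_const, Finset.card_range]
        rw [if_neg (by omega), if_neg (by omega), abs_pow]
        have h1 : δ ^ k * Y = 2 * |(B.coeff 0 : ℝ)| ^ r := by
          rw [hY, ← mul_div_assoc, ← mul_assoc, ← pow_succ, hδp]
          field_simp
          rw [← pow_succ, Nat.sub_add_cancel hr]
        rw [h1]
        have : 0 < |(B.coeff 0 : ℝ)| ^ r := by positivity
        linarith
      · intro i hi
        have := Finset.mem_range.1 hi
        rw [if_neg (by omega), if_pos (by omega)]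
      · intro i hi
        rw [if_pos (Finset.mem_range.1 hi)])
  set z : ℕ → ℤ := fun i => if h : i < N + 1 then z' ⟨i, h⟩ else 0 with hz
  have hzz : ∀ i : Fin (N + 1), z' i = z i := fun i => by simp only [hz]; rw [dif_pos i.is_lt]
  have hmul : ∀ i : Fin (N + 1), (recurrenceMatrix N r ξ B).mulVec (fun j => (z' j : ℝ)) i =
      ∑ j : Fin (N + 1), recurrenceMatrix N r ξ B i j * z j := fun i => by
    simp [Matrix.mulVec, dotProduct, hzz]
  -- The first `r` forms take integer values smaller than `1`, hence vanish.
  have hrel : ∀ i < r, ∑ l ∈ Finset.range (k + 2), (B.coeff l : ℝ) * z (i + l) = 0 := by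
    intro i hi
    have h1 := hz' ⟨i, by omega⟩
    rw [hmul] at h1
    simp only [if_pos hi] at h1
    have h2 : ∑ j : Fin (N + 1), recurrenceMatrix N r ξ B (⟨i, by omega⟩ : Fin (N + 1)) j * z j =
        ∑ l ∈ Finset.range (k + 2), (B.coeff l : ℝ) * z (i + l) := by
      have h3 : ∀ j : Fin (N + 1), recurrenceMatrix N r ξ B (⟨i, by omega⟩ : Fin (N + 1)) j * z j =
          (fun j : ℕ => if i ≤ j then (B.coeff (j - i) : ℝ) * z j else 0) j := by
        intro j
        rw [recurrenceMatrix_apply, if_pos hi]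
        simp [Fin.le_def, ite_mul]
      refine (Finset.sum_congr rfl fun j _ => h3 j).trans ?_
      rw [Fin.sum_univ_eq_sum_range (fun j : ℕ => if i ≤ j then (B.coeff (j - i) : ℝ) * z j else 0),
        show N + 1 = i + (k + 2 + (r - 1 - i)) by omega, Finset.sum_range_add,
        Finset.sum_eq_zero (s := Finset.range i), zero_add, Finset.sum_range_add,
        Finset.sum_eq_zero (s := Finset.range (r - 1 - i)), add_zero]
      · refine Finset.sum_congr rfl fun l _ => ?_
        simp
      · intro l _
        rw [if_pos (by omega), coeff_eq_zero_of_natDegree_lt (by omega)]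
        simp
      · intro l hl
        rw [if_neg (by have := Finset.mem_range.1 hl; omega)]
    rw [h2] at h1
    have h4 : |∑ l ∈ Finset.range (k + 2), B.coeff l * z (i + l)| < 1 := by exact_mod_cast h1
    exact_mod_cast Int.abs_lt_one_iff.1 h4
  -- `v` measures the distance to the geometric progression through the last coordinate.
  set q : ℝ := z N / ξ ^ N with hq
  set v : ℕ → ℝ := fun i => z i - ξ ^ i * q with hv
  have hvN : v N = 0 := by
    simp only [hv, hq]
    field_simp
    ring
  have hqY : |q| ≤ Y / |ξ| ^ N := by
    have h1 := hz' (Fin.last N)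
    rw [hmul, Finset.sum_eq_single (Fin.last N)] at h1
    · have hlt : ¬ N < r := by omega
      simp only [recurrenceMatrix_apply, Fin.val_last, hlt, if_false, if_true,
        lt_irrefl, one_mul] at h1
      rw [hq, abs_div, abs_pow]
      gcongr
    · intro j _ hj
      have hlt : ¬ N < r := by omega
      simp [recurrenceMatrix_apply, hlt, hj]
    · simp
  have htail : ∀ i, r ≤ i → i ≤ N → |v i| ≤ δ := by
    intro i hi hiN
    rcases hiN.eq_or_lt with rfl | hlt
    · rw [hvN, abs_zero]; exact hδ.le
    have h1 := hz' ⟨i, by omega⟩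
    have hi' : ¬ i < r := not_lt.2 hi
    have hne : (⟨i, by omega⟩ : Fin (N + 1)) ≠ Fin.last N := by
      simp [Fin.ext_iff, hlt.ne]
    rw [hmul, Finset.sum_eq_add (⟨i, by omega⟩ : Fin (N + 1)) (Fin.last N) hne] at h1
    · simp only [recurrenceMatrix_apply, Fin.val_last, hi', if_false, if_true,
        one_mul, hne.symm, if_pos hlt] at h1
      have h2 : v i = z i + -(ξ ^ i / ξ ^ N) * z N := by
        simp only [hv, hq]
        ring
      rw [h2]
      exact h1.le
    · intro j _ hj
      simp [recurrenceMatrix_apply, hi', hj.1, hj.2]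
    · simp
    · simp
  have hξi : ∀ i ≤ N, |ξ| ^ i ≤ (1 + |ξ|) ^ N := fun i hi =>
    calc |ξ| ^ i ≤ (1 + |ξ|) ^ i := by gcongr; linarith
      _ ≤ _ := pow_le_pow_right₀ (by linarith) hi
  have hrec : ∀ i < r, |v i| ≤ D * δ + K * ∑ l ∈ Finset.range (k + 1), |v (i + l + 1)| := by
    intro i hi
    have h1 : (B.coeff 0 : ℝ) * v i = -(ξ ^ i * q * aeval ξ B) -
        ∑ l ∈ Finset.range (k + 1), (B.coeff (l + 1) : ℝ) * v (i + l + 1) := by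
      have h2 : ∑ l ∈ Finset.range (k + 2), (B.coeff l : ℝ) * v (i + l) =
          -(ξ ^ i * q * aeval ξ B) := by
        rw [aeval_eq_sum_range' (n := k + 2) (by omega), Finset.mul_sum, ← Finset.sum_neg_distrib,
          ← sub_eq_zero, ← Finset.sum_sub_distrib, ← hrel i hi]
        refine Finset.sum_congr rfl fun l _ => ?_
        simp only [hv, zsmul_eq_mul, pow_add]
        ring
      rw [← h2, Finset.sum_range_succ']
      simp [add_assoc]
    have h3 : |(B.coeff 0 : ℝ)| * |v i| ≤ |(B.coeff 0 : ℝ)| *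
        (D * δ + K * ∑ l ∈ Finset.range (k + 1), |v (i + l + 1)|) := by
      rw [← abs_mul, h1, mul_add]
      refine (abs_sub _ _).trans (add_le_add ?_ ?_)
      · rw [abs_neg, abs_mul, abs_mul, abs_pow]
        calc |ξ| ^ i * |q| * |aeval ξ B| ≤ (1 + |ξ|) ^ N * (Y / |ξ| ^ N) * p := by
              gcongr
              exact hξi i (by omega)
          _ = |(B.coeff 0 : ℝ)| * (D * δ) := by
              rw [hY, hD]
              field_simp
      · rw [← mul_assoc, Finset.mul_sum]
        refine (Finset.abs_sum_le_sum_abs _ _).trans (Finset.sum_le_sum fun l _ => ?_)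
        rw [abs_mul]
        gcongr
        rw [mul_comm]
        exact hBK _
    exact le_of_mul_le_mul_left h3 hb
  have hall := abs_le_of_backward_recurrence (by omega) (by omega) hD0.le hK hδ htail hrec
  have hv0 : (z 0 : ℝ) = v 0 + q := by simp [hv]
  have h0 := hall 0 (Nat.zero_le _)
  have hZ : 0 < (1 + |ξ|) ^ N := by positivity
  refine ⟨z, ?_, ?_, fun i hi => ?_⟩
  · by_contra! hcon
    apply hz'0
    ext i
    rw [hzz, hcon i (by omega)]
    rfl
  · rw [hv0]
    calc |v 0 + q| ≤ |v 0| + |q| := abs_add_le _ _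
      _ ≤ E * δ + Y / |ξ| ^ N := add_le_add h0 hqY
      _ ≤ _ := by
          have h1 : 0 ≤ E * (1 + |ξ|) ^ N * δ := by positivity
          have h2 : 0 ≤ E * (1 + (1 + |ξ|) ^ N) * Y := by positivity
          have h3 : 0 ≤ 1 / |ξ| ^ N * δ := by positivity
          have h4 : Y / |ξ| ^ N = 1 / |ξ| ^ N * Y := by ring
          rw [h4]
          nlinarith
  · have h1 : (z i : ℝ) - ξ ^ i * z 0 = v i - ξ ^ i * v 0 := by
      rw [hv0]
      simp only [hv]
      ring
    rw [h1]
    calc |v i - ξ ^ i * v 0| ≤ |v i| + |ξ ^ i * v 0| := abs_sub _ _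
      _ ≤ E * δ + (1 + |ξ|) ^ N * (E * δ) := by
          rw [abs_mul, abs_pow]
          gcongr
          · exact hall i hi
          · exact hξi i hi
      _ ≤ _ := by
          have h3 : 0 ≤ 1 / |ξ| ^ N * δ := by positivity
          nlinarith

/-! ### Evaluation and translation at small integers -/

/-- An integer polynomial of degree at most `n` is of size comparable to its height at one of the
points `0, …, n`. -/
theorem exists_eval_natCast_ge (n : ℕ) : ∃ c : ℝ, 0 < c ∧ ∀ P : ℤ[X], P.natDegree ≤ n →
    ∃ m : Fin (n + 1), c * P.supNorm ≤ |((P.eval ((m : ℕ) : ℤ) : ℤ) : ℝ)| := by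
  set V : Matrix (Fin (n + 1)) (Fin (n + 1)) ℝ :=
    Matrix.vandermonde fun i : Fin (n + 1) => ((i : ℕ) : ℝ) with hV
  have hdet : IsUnit V.det := by
    rw [isUnit_iff_ne_zero, hV, Matrix.det_vandermonde_ne_zero_iff]
    intro i j hij
    exact Fin.ext (Nat.cast_injective (R := ℝ) hij)
  set S : ℝ := 1 + ∑ i, ∑ j, |V⁻¹ i j| with hS
  have hS0 : 0 < S := by positivity
  refine ⟨1 / S, by positivity, fun P hP => ?_⟩
  by_contra! hcon
  have hs : 0 < P.supNorm := by
    by_contra h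
    have h0 : P.supNorm = 0 := le_antisymm (not_lt.1 h) P.supNorm_nonneg
    have := hcon 0
    rw [h0, mul_zero] at this
    exact absurd this (not_lt.2 (abs_nonneg _))
  set a : Fin (n + 1) → ℝ := fun i => (P.coeff i : ℝ) with ha
  have hVa : ∀ j, V.mulVec a j = ((P.eval ((j : ℕ) : ℤ) : ℤ) : ℝ) := by
    intro j
    rw [eval_eq_sum_range' (Nat.lt_succ_of_le hP), Finset.sum_range]
    simp [Matrix.mulVec, dotProduct, hV, Matrix.vandermonde_apply, ha, mul_comm]
  have hinv : a = V⁻¹.mulVec (V.mulVec a) := by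
    rw [Matrix.mulVec_mulVec, Matrix.nonsing_inv_mul _ hdet, Matrix.one_mulVec]
  obtain ⟨i, hi⟩ := P.exists_eq_supNorm
  have hin : i < n + 1 := by
    by_contra h
    rw [coeff_eq_zero_of_natDegree_lt (by omega)] at hi
    simp at hi
    linarith
  have h1 : P.supNorm = |a ⟨i, hin⟩| := by
    rw [hi, Int.norm_eq_abs]
  have h2 : |a ⟨i, hin⟩| ≤ ∑ j, |V⁻¹ ⟨i, hin⟩ j| * (1 / S * P.supNorm) := by
    have h2' : a ⟨i, hin⟩ = ∑ j, V⁻¹ ⟨i, hin⟩ j * V.mulVec a j := congrFun hinv ⟨i, hin⟩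
    rw [h2']
    refine (Finset.abs_sum_le_sum_abs _ _).trans (Finset.sum_le_sum fun j _ => ?_)
    rw [abs_mul, hVa]
    gcongr
    exact (hcon j).le
  have h3 : ∑ j, |V⁻¹ ⟨i, hin⟩ j| ≤ S - 1 := by
    rw [hS, add_sub_cancel_left]
    exact Finset.single_le_sum (f := fun i => ∑ j, |V⁻¹ i j|)
      (fun i _ => Finset.sum_nonneg fun j _ => abs_nonneg _) (Finset.mem_univ _)
  rw [← Finset.sum_mul, ← h1] at h2
  have h4 : P.supNorm ≤ (S - 1) * (1 / S * P.supNorm) :=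
    h2.trans (mul_le_mul_of_nonneg_right h3 (by positivity))
  have h5 : (S - 1) * (1 / S * P.supNorm) = P.supNorm - P.supNorm / S := by
    field_simp
  have h6 : 0 < P.supNorm / S := by positivity
  linarith

theorem exists_taylor_coeff_le (n : ℕ) (m : ℤ) : ∃ K : ℝ, 0 ≤ K ∧
    ∀ P : ℤ[X], P.natDegree ≤ n → ∀ k, |((taylor m P).coeff k : ℝ)| ≤ K * P.supNorm := by
  refine ⟨∑ i ∈ Finset.range (n + 1), ((X + C m) ^ i : ℤ[X]).supNorm,
    Finset.sum_nonneg fun i _ => supNorm_nonneg _, fun P hP k => ?_⟩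
  have h : (taylor m P).coeff k =
      ∑ i ∈ Finset.range (n + 1), P.coeff i * ((X + C m) ^ i : ℤ[X]).coeff k := by
    conv_lhs => rw [P.as_sum_range' (n + 1) (Nat.lt_succ_of_le hP), map_sum, finsetSum_coeff]
    refine Finset.sum_congr rfl fun i _ => ?_
    rw [taylor_monomial, coeff_C_mul]
  rw [h, Finset.sum_mul]
  push_cast
  refine (Finset.abs_sum_le_sum_abs _ _).trans (Finset.sum_le_sum fun i _ => ?_)
  rw [abs_mul, mul_comm]
  exact mul_le_mul (abs_coeff_le_supNorm _ _) (abs_coeff_le_supNorm _ _) (abs_nonneg _)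
    (supNorm_nonneg _)

/-- Translating by `m` turns an approximate geometric progression of ratio `ξ` into one of ratio
`ξ + m`. -/
theorem exists_shift_near_geometric (N : ℕ) (m : ℤ) : ∃ K : ℝ, 0 ≤ K ∧
    ∀ (ξ ε : ℝ) (z : ℕ → ℤ), (∀ i ≤ N, |(z i : ℝ) - ξ ^ i * z 0| ≤ ε) →
      ∃ y : ℕ → ℤ, ∀ i ≤ N, |(ξ + m) ^ i * z 0 - y i| ≤ K * ε := by
  set K : ℝ := ∑ i ∈ Finset.range (N + 1), ∑ k ∈ Finset.range (N + 1),
    |(((X + C m) ^ i : ℤ[X]).coeff k : ℝ)| with hK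
  refine ⟨K, by positivity, fun ξ ε z h => ⟨fun i => ∑ k ∈ Finset.range (N + 1),
    ((X + C m) ^ i : ℤ[X]).coeff k * z k, fun i hi => ?_⟩⟩
  have hε : 0 ≤ ε := (abs_nonneg _).trans (h 0 (Nat.zero_le _))
  have hdeg : ((X + C m) ^ i : ℤ[X]).natDegree < N + 1 := by
    rw [natDegree_pow, natDegree_X_add_C]
    omega
  have h1 : (ξ + m) ^ i = ∑ k ∈ Finset.range (N + 1),
      (((X + C m) ^ i : ℤ[X]).coeff k : ℝ) * ξ ^ k := by
    have h2 : aeval ξ ((X + C m) ^ i : ℤ[X]) = (ξ + m) ^ i := by simp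
    rw [← h2, aeval_eq_sum_range' hdeg]
    simp
  have h3 : (ξ + m) ^ i * z 0 - ((∑ k ∈ Finset.range (N + 1),
      ((X + C m) ^ i : ℤ[X]).coeff k * z k : ℤ) : ℝ) = ∑ k ∈ Finset.range (N + 1),
      -((((X + C m) ^ i : ℤ[X]).coeff k : ℝ) * (z k - ξ ^ k * z 0)) := by
    rw [h1, Finset.sum_mul]
    push_cast
    rw [← Finset.sum_sub_distrib]
    refine Finset.sum_congr rfl fun k _ => ?_
    ring
  rw [h3]
  calc |∑ k ∈ Finset.range (N + 1),
        -((((X + C m) ^ i : ℤ[X]).coeff k : ℝ) * (z k - ξ ^ k * z 0))|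
      ≤ ∑ k ∈ Finset.range (N + 1), |(((X + C m) ^ i : ℤ[X]).coeff k : ℝ)| * ε := by
        refine (Finset.abs_sum_le_sum_abs _ _).trans (Finset.sum_le_sum fun k hk => ?_)
        rw [abs_neg, abs_mul]
        gcongr
        exact h k (Nat.lt_succ_iff.1 (Finset.mem_range.1 hk))
    _ ≤ K * ε := by
        rw [← Finset.sum_mul]
        gcongr
        rw [hK]
        exact Finset.single_le_sum (f := fun i => ∑ k ∈ Finset.range (N + 1),
          |(((X + C m) ^ i : ℤ[X]).coeff k : ℝ)|)
          (fun i _ => Finset.sum_nonneg fun k _ => abs_nonneg _)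
          (Finset.mem_range.2 (Nat.lt_succ_of_le hi))

/-! ### Lower bound for simultaneous approximation -/

/-- The case of `exists_simultaneous_of_poly` in which `P` is of size comparable to its height at
the integer `m`: then the recurrence attached to the Taylor coefficients of `P` at `m` is
well-conditioned. -/
theorem exists_simultaneous_of_poly_at {n N : ℕ} {ζ t c : ℝ} (hζ : Transcendental ℚ ζ)
    (hn : 1 ≤ n) (hnN : n ≤ N) (ht : (N : ℝ) < n + t) (m : ℤ) (hc : 0 < c) :
    ∃ C H₀ : ℝ, 0 < C ∧ ∀ P : ℤ[X], P ≠ 0 → P.natDegree ≤ n →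
      |aeval ζ P| ≤ P.supNorm ^ (-t) → c * P.supNorm ≤ |((P.eval m : ℤ) : ℝ)| →
      H₀ ≤ P.supNorm → ∃ y : ℕ → ℤ, y 0 ≠ 0 ∧
        |(y 0 : ℝ)| ≤ C * P.supNorm ^ (((n - 1) * t + N) / n) ∧
        ∀ i ≤ N, |ζ ^ i * y 0 - y i| ≤ C * P.supNorm ^ (-((n + t - N) / n)) := by
  obtain ⟨K₁, hK₁, htaylor⟩ := exists_taylor_coeff_le n m
  obtain ⟨K₂, hK₂, hshift⟩ := exists_shift_near_geometric N m
  obtain ⟨k, rfl⟩ : ∃ k, n = k + 1 := ⟨n - 1, by omega⟩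
  obtain ⟨a, rfl⟩ : ∃ a, N = (a + 1) + k := ⟨N - (k + 1), by omega⟩
  have hξ : ζ - m ≠ 0 := by
    intro h
    have h1 : aeval ζ (X - C m : ℤ[X]) = 0 := by simpa using h
    exact aeval_ne_zero hζ (X_sub_C_ne_zero m) h1
  obtain ⟨C₀, hC₀, hcore⟩ := exists_recurrence_near_geometric (r := a + 1) (k := k) (by omega) hξ
    (div_nonneg hK₁ hc.le)
  set n' : ℝ := ((k + 1 : ℕ) : ℝ) with hn'
  have hn'0 : 0 < n' := by positivity
  have hn'k : n' = k + 1 := by simp [hn']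
  set e₁ : ℝ := (n' + t - ((a + 1 + k : ℕ) : ℝ)) / n' with he₁
  set e₂ : ℝ := ((n' - 1) * t + ((a + 1 + k : ℕ) : ℝ)) / n' with he₂
  have he₁0 : 0 < e₁ := div_pos (by linarith) hn'0
  have hNa : ((a + 1 + k : ℕ) : ℝ) = a + n' := by rw [hn'k]; push_cast; ring
  have ht0 : 0 < t := by
    have : (0 : ℝ) ≤ a := by positivity
    linarith
  have he₂0 : 0 < e₂ := by
    refine div_pos ?_ hn'0
    rw [hNa, hn'k]
    have : (0 : ℝ) ≤ k * t := by positivity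
    have : (0 : ℝ) ≤ a := by positivity
    nlinarith
  have he₁₂ : 1 + t - e₁ = e₂ := by
    rw [he₁, he₂]
    field_simp
    ring
  set Q : ℝ := (2 * K₁ ^ a) ^ (1 / n') with hQ
  have hQ0 : 0 ≤ Q := Real.rpow_nonneg (mul_nonneg zero_le_two (pow_nonneg hK₁ _)) _
  -- Beyond the height `H₀`, the approximations are nonzero.
  obtain ⟨H₀, hH₀⟩ := eventually_atTop.1
    (((tendsto_rpow_neg_atTop he₁0).const_mul (C₀ * Q)).eventually_lt_const
      (show C₀ * Q * 0 < 1 by simp))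
  refine ⟨1 + C₀ * (Q * K₁ + Q) + K₂ * (C₀ * Q), H₀, by positivity,
    fun P hP0 hPd hPζ hPm hPH => ?_⟩
  set H := P.supNorm with hH
  have hH1 : 1 ≤ H := one_le_supNorm hP0
  have hHpos : 0 < H := by linarith
  have hb_low : c * H ≤ |((taylor m P).coeff 0 : ℝ)| := by rw [taylor_coeff_zero]; exact hPm
  have hb_up : |((taylor m P).coeff 0 : ℝ)| ≤ K₁ * H := htaylor P hPd 0
  have hbpos : 0 < |((taylor m P).coeff 0 : ℝ)| := lt_of_lt_of_le (by positivity) hb_low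
  have haev : aeval (ζ - m) (taylor m P) = aeval ζ P := by
    have h1 : aeval (ζ - m) (taylor m P) = aeval (ζ - m + m) P := by
      rw [taylor_apply, aeval_comp]
      simp
    rw [h1, sub_add_cancel]
  set b : ℝ := |((taylor m P).coeff 0 : ℝ)| with hb
  set p : ℝ := H ^ (-t) with hp
  have hp0 : 0 < p := by positivity
  set δ : ℝ := (2 * b ^ a * p) ^ (1 / n') with hδ
  have hδ0 : 0 < δ := by positivity
  have hδpow : δ ^ (k + 1) = 2 * b ^ (a + 1 - 1) * p := by
    rw [hδ, ← Real.rpow_natCast, ← Real.rpow_mul (by positivity), ← hn', one_div,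
      inv_mul_cancel₀ hn'0.ne', Real.rpow_one, Nat.add_sub_cancel]
  obtain ⟨z, hz0, hzb, hzε⟩ := hcore (taylor m P) (by rw [natDegree_taylor]; exact hPd)
    (by
      intro h0
      rw [hb, h0] at hbpos
      simp at hbpos)
    (by
      intro i
      refine (htaylor P hPd i).trans ?_
      rw [div_mul_eq_mul_div, le_div_iff₀ hc, mul_assoc, mul_comm _ c]
      exact mul_le_mul_of_nonneg_left hb_low hK₁)
    p hp0 (by rw [haev]; exact hPζ) δ hδ0 hδpow
  have hδle : δ ≤ Q * H ^ (-e₁) := by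
    have h1 : 2 * b ^ a * p ≤ 2 * K₁ ^ a * H ^ ((a : ℝ) - t) := by
      rw [sub_eq_add_neg, Real.rpow_add hHpos, Real.rpow_natCast]
      calc 2 * b ^ a * p ≤ 2 * (K₁ * H) ^ a * p := by gcongr
        _ = _ := by rw [mul_pow]; ring
    have h2 : δ ≤ (2 * K₁ ^ a * H ^ ((a : ℝ) - t)) ^ (1 / n') :=
      Real.rpow_le_rpow (by positivity) h1 (by positivity)
    refine h2.trans (le_of_eq ?_)
    rw [Real.mul_rpow (mul_nonneg zero_le_two (pow_nonneg hK₁ _)) (by positivity),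
      ← Real.rpow_mul hHpos.le]
    congr 2
    rw [he₁, hNa]
    field_simp
    ring
  have hsmall : C₀ * δ < 1 := by
    refine lt_of_le_of_lt ?_ (hH₀ H hPH)
    rw [mul_assoc]
    exact mul_le_mul_of_nonneg_left hδle hC₀.le
  rw [← hb] at hzb
  clear_value δ p b H Q e₁ e₂ n'
  have hz0' : z 0 ≠ 0 := by
    intro h0
    obtain ⟨i, hi, hzi⟩ := hz0
    have h1 := (hzε i hi).trans_lt hsmall
    rw [h0] at h1
    simp only [Int.cast_zero, mul_zero, sub_zero] at h1
    exact hzi (Int.abs_lt_one_iff.1 (by exact_mod_cast h1))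
  obtain ⟨y, hy⟩ := hshift (ζ - m) (C₀ * δ) z hzε
  rw [sub_add_cancel] at hy
  have hHe : H ^ (-e₁) ≤ H ^ e₂ := Real.rpow_le_rpow_of_exponent_le hH1 (by linarith)
  have hHe₂ : 0 < H ^ e₂ := by positivity
  have hHe₁ : 0 < H ^ (-e₁) := by positivity
  refine ⟨fun i => if i = 0 then z 0 else y i, by simpa using hz0', ?_, fun i hi => ?_⟩
  · simp only [if_true]
    have h1 : δ * b / p ≤ Q * K₁ * H ^ e₂ := by
      have h2 : H ^ (-e₁) * H / p = H ^ e₂ := by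
        rw [hp, ← Real.rpow_add_one hHpos.ne', ← Real.rpow_sub hHpos]
        congr 1
        linarith
      calc δ * b / p ≤ (Q * H ^ (-e₁)) * (K₁ * H) / p := by gcongr
        _ = Q * K₁ * (H ^ (-e₁) * H / p) := by ring
        _ = _ := by rw [h2]
    have h3 : δ ≤ Q * H ^ e₂ := hδle.trans (mul_le_mul_of_nonneg_left hHe hQ0)
    calc |(z 0 : ℝ)| ≤ C₀ * (Q * K₁ * H ^ e₂ + Q * H ^ e₂) :=
          hzb.trans (mul_le_mul_of_nonneg_left (add_le_add h1 h3) hC₀.le)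
      _ = C₀ * (Q * K₁ + Q) * H ^ e₂ := by ring
      _ ≤ _ := by
          refine mul_le_mul_of_nonneg_right ?_ hHe₂.le
          have : 0 ≤ K₂ * (C₀ * Q) := by positivity
          linarith
  · rcases Nat.eq_zero_or_pos i with rfl | hi0
    · simp only [if_true, pow_zero, one_mul, sub_self, abs_zero]
      positivity
    · simp only [if_true, if_neg hi0.ne']
      calc |ζ ^ i * z 0 - y i| ≤ K₂ * (C₀ * (Q * H ^ (-e₁))) :=
            (hy i hi).trans (mul_le_mul_of_nonneg_left (mul_le_mul_of_nonneg_left hδle hC₀.le) hK₂)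
        _ = K₂ * (C₀ * Q) * H ^ (-e₁) := by ring
        _ ≤ _ := by
            refine mul_le_mul_of_nonneg_right ?_ hHe₁.le
            have : 0 ≤ C₀ * (Q * K₁ + Q) := by positivity
            linarith

/-- A polynomial of degree at most `n` and height `H` with `|P ζ| ≤ H ^ (-t)` yields a good
simultaneous approximation to `(ζ, …, ζ ^ N)`, for `N ≥ n`. -/
theorem exists_simultaneous_of_poly {n N : ℕ} {ζ t : ℝ} (hζ : Transcendental ℚ ζ) (hn : 1 ≤ n)
    (hnN : n ≤ N) (ht : (N : ℝ) < n + t) : ∃ C H₀ : ℝ, 0 < C ∧ ∀ P : ℤ[X], P ≠ 0 →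
      P.natDegree ≤ n → |aeval ζ P| ≤ P.supNorm ^ (-t) → H₀ ≤ P.supNorm →
      ∃ y : ℕ → ℤ, y 0 ≠ 0 ∧ |(y 0 : ℝ)| ≤ C * P.supNorm ^ (((n - 1) * t + N) / n) ∧
        ∀ i ≤ N, |ζ ^ i * y 0 - y i| ≤ C * P.supNorm ^ (-((n + t - N) / n)) := by
  obtain ⟨c, hc, hlow⟩ := exists_eval_natCast_ge n
  choose C H₀ hC hmain using fun m : Fin (n + 1) =>
    exists_simultaneous_of_poly_at hζ hn hnN ht ((m : ℕ) : ℤ) hc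
  obtain ⟨C', hC'⟩ := Finite.exists_le C
  obtain ⟨H', hH'⟩ := Finite.exists_le H₀
  refine ⟨C', H', (hC 0).trans_le (hC' 0), fun P hP0 hPd hPζ hPH => ?_⟩
  obtain ⟨m, hm⟩ := hlow P hPd
  obtain ⟨y, hy0, hy1, hy2⟩ := hmain m P hP0 hPd hPζ hm ((hH' m).trans hPH)
  have hs := P.supNorm_nonneg
  exact ⟨y, hy0, hy1.trans (mul_le_mul_of_nonneg_right (hC' m) (Real.rpow_nonneg hs _)),
    fun i hi => (hy2 i hi).trans (mul_le_mul_of_nonneg_right (hC' m) (Real.rpow_nonneg hs _))⟩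

/-- The transference lower bound. -/
theorem le_lam_of_lt_w {n N : ℕ} {ζ t : ℝ} (hζ : Transcendental ℚ ζ) (hn : 1 ≤ n)
    (hnN : n ≤ N) (ht : (N : ℝ) < n + t) (hw : (t : EReal) < w n ζ) :
    (((n + t - N) / ((n - 1) * t + N) : ℝ) : EReal) ≤ lam N ζ := by
  obtain ⟨C, H₀, hC, hmain⟩ := exists_simultaneous_of_poly hζ hn hnN ht
  have hn0 : (1 : ℝ) ≤ n := by exact_mod_cast hn
  have hnN' : (n : ℝ) ≤ N := by exact_mod_cast hnN
  have ht0 : 0 < t := by linarith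
  set e₁ : ℝ := (n + t - N) / n with he₁
  set e₂ : ℝ := ((n - 1) * t + N) / n with he₂
  have he₂0 : 0 < e₂ := by
    refine div_pos ?_ (by linarith)
    have : 0 ≤ ((n : ℝ) - 1) * t := mul_nonneg (by linarith) ht0.le
    linarith
  have hratio : (n + t - N) / ((n - 1) * t + N) = e₁ / e₂ := by
    rw [he₁, he₂, div_div_div_cancel_right₀ (by linarith)]
  rw [hratio]
  refine EReal.ge_of_forall_gt_iff_ge.1 fun l hl => ?_
  have hl' : l < e₁ / e₂ := by exact_mod_cast hl
  have hle : l * e₂ < e₁ := (lt_div_iff₀ he₂0).1 hl'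
  refine le_iSup₂_of_le (f := fun (l : ℝ) (_ : ∃ᶠ X : ℝ in atTop, ∃ (x : ℤ) (y : Fin N → ℤ),
    1 ≤ |x| ∧ ((|x| : ℤ) : ℝ) ≤ X ∧
      ∀ i : Fin N, |ζ ^ ((i : ℕ) + 1) * (x : ℝ) - (y i : ℝ)| ≤ X ^ (-l)) => (l : EReal)) l ?_ le_rfl
  rw [frequently_atTop]
  intro X₀
  have hev₁ : ∀ᶠ H : ℝ in atTop, X₀ ≤ C * H ^ e₂ :=
    ((tendsto_rpow_atTop he₂0).const_mul_atTop hC).eventually_ge_atTop X₀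
  have hev₂ : ∀ᶠ H : ℝ in atTop, C ^ (1 + l) * H ^ (-(e₁ - l * e₂)) < 1 := by
    have := (tendsto_rpow_neg_atTop (sub_pos.2 hle)).const_mul (C ^ (1 + l))
    rw [mul_zero] at this
    exact this.eventually_lt_const one_pos
  obtain ⟨H₁, hH₁⟩ := eventually_atTop.1 (hev₁.and hev₂)
  obtain ⟨P, hPd, hP0, hPζ, hPH⟩ := exists_poly_of_lt_w hw (max H₀ H₁)
  have hPne : P ≠ 0 := by rintro rfl; simp at hP0
  obtain ⟨y, hy0, hyX, hyi⟩ := hmain P hPne hPd hPζ ((le_max_left _ _).trans hPH)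
  obtain ⟨h1, h2⟩ := hH₁ P.supNorm ((le_max_right _ _).trans hPH)
  have hH : 0 < P.supNorm := zero_lt_one.trans_le (one_le_supNorm hPne)
  refine ⟨C * P.supNorm ^ e₂, h1, y 0, fun i => y (i + 1), Int.one_le_abs hy0,
    by exact_mod_cast hyX, fun i => (hyi (i + 1) (by omega)).trans ?_⟩
  have h3 : C ^ (1 + l) * P.supNorm ^ (-(e₁ - l * e₂)) =
      C * P.supNorm ^ (-e₁) / (C * P.supNorm ^ e₂) ^ (-l) := by
    rw [Real.mul_rpow hC.le (by positivity), ← Real.rpow_mul hH.le, Real.rpow_add hC,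
      Real.rpow_one, mul_div_mul_comm, ← Real.rpow_sub hH, Real.rpow_neg hC.le l, div_inv_eq_mul]
    congr 2
    ring
  rw [h3, div_lt_one (by positivity)] at h2
  exact h2.le

end Transference

section Limits

open scoped Topology

/-! ### Normalised exponents -/

theorem coe_lt_w_div_iff {n : ℕ} (hn : 1 ≤ n) {ζ t : ℝ} :
    (t : EReal) < w n ζ / n ↔ ((t * n : ℝ) : EReal) < w n ζ := by
  rw [EReal.lt_div_iff (by exact_mod_cast hn) (EReal.natCast_ne_top n), EReal.coe_mul,
    EReal.coe_coe_eq_natCast]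

theorem w_div_lt_coe_iff {n : ℕ} (hn : 1 ≤ n) {ζ t : ℝ} :
    w n ζ / n < (t : EReal) ↔ w n ζ < ((t * n : ℝ) : EReal) := by
  rw [EReal.div_lt_iff (by exact_mod_cast hn) (EReal.natCast_ne_top n), EReal.coe_mul,
    EReal.coe_coe_eq_natCast]

theorem one_le_w_div {ζ : ℝ} (hζ : Transcendental ℚ ζ) {n : ℕ} (hn : 1 ≤ n) :
    1 ≤ w n ζ / n := by
  rw [EReal.le_div_iff_mul_le (by exact_mod_cast hn) (EReal.natCast_ne_top n), one_mul]
  exact le_w hζ hn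

theorem one_le_wInf {ζ : ℝ} (hζ : Transcendental ℚ ζ) : 1 ≤ wInf ζ :=
  le_liminf_of_le (by isBoundedDefault)
    ((eventually_ge_atTop 1).mono fun _ hn => one_le_w_div hζ hn)

theorem one_le_wSup {ζ : ℝ} (hζ : Transcendental ℚ ζ) : 1 ≤ wSup ζ :=
  (one_le_wInf hζ).trans liminf_le_limsup

theorem natCast_mul_coe (N : ℕ) (x : ℝ) : (N : EReal) * (x : EReal) = ((N * x : ℝ) : EReal) := by
  rw [EReal.coe_mul, EReal.coe_coe_eq_natCast]

theorem natCast_mul_le_natCast_mul (N : ℕ) {x y : EReal} (h : x ≤ y) :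
    (N : EReal) * x ≤ (N : EReal) * y :=
  mul_le_mul_of_nonneg_left h (by exact_mod_cast N.zero_le)

/-- The transference lower bound along a sequence with `N / n → s`. -/
theorem eventually_le_natCast_mul_lam {ι : Type*} {f : Filter ι} {n N : ι → ℕ} {ζ s t a : ℝ}
    (hζ : Transcendental ℚ ζ) (ht : 0 < t) (hst : s < 1 + t) (ha : a < s * (1 + t - s) / t)
    (hn : Tendsto n f atTop) (hN : Tendsto (fun i => (N i : ℝ) / n i) f (𝓝 s))
    (hle : ∀ᶠ i in f, n i ≤ N i) :
    ∀ᶠ i in f, (t : EReal) < w (n i) ζ / (n i : EReal) → (a : EReal) ≤ N i * lam (N i) ζ := by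
  have hinv : Tendsto (fun i => ((n i : ℝ))⁻¹) f (𝓝 0) :=
    tendsto_inv_atTop_zero.comp (tendsto_natCast_atTop_atTop.comp hn)
  have hlim : Tendsto (fun i => (N i : ℝ) / n i * (1 + t - (N i : ℝ) / n i) /
      ((1 - ((n i : ℝ))⁻¹) * t + (N i : ℝ) / n i * ((n i : ℝ))⁻¹)) f
      (𝓝 (s * (1 + t - s) / t)) := by
    have h1 := (hN.mul (hN.const_sub (1 + t))).div
      (((hinv.const_sub 1).mul_const t).add (hN.mul hinv)) (by simpa using ht.ne')
    simp only [sub_zero, one_mul, mul_zero, add_zero] at h1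
    exact h1
  filter_upwards [hn.eventually_ge_atTop 1, hN.eventually_lt_const hst, hle,
    hlim.eventually_const_lt ha] with i hi1 hi2 hi3 hi4 hiw
  have hn0 : (0 : ℝ) < n i := by exact_mod_cast hi1
  have hlt : (N i : ℝ) < n i + t * n i := by
    rw [div_lt_iff₀ hn0] at hi2
    linarith
  have h := le_lam_of_lt_w hζ hi1 hi3 hlt ((coe_lt_w_div_iff hi1).1 hiw)
  refine le_trans ?_ (natCast_mul_le_natCast_mul _ h)
  rw [natCast_mul_coe, EReal.coe_le_coe_iff]
  refine hi4.le.trans (le_of_eq ?_)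
  have hn1 : (1 : ℝ) ≤ n i := by exact_mod_cast hi1
  have hN1 : (0 : ℝ) < N i := by exact_mod_cast hi1.trans hi3
  have hd : 0 < ((n i : ℝ) - 1) * t + N i / n i := by
    have : 0 ≤ ((n i : ℝ) - 1) * t := mul_nonneg (by linarith) ht.le
    positivity
  have hd1 : (1 - ((n i : ℝ))⁻¹) * t + (N i : ℝ) / n i * ((n i : ℝ))⁻¹ =
      (((n i : ℝ) - 1) * t + N i / n i) / n i := by
    field_simp
  have hd2 : ((n i : ℝ) - 1) * (t * n i) + N i = (((n i : ℝ) - 1) * t + N i / n i) * n i := by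
    field_simp
  rw [hd1, hd2]
  field_simp

theorem tendsto_ceil_mul_natCast_div {s : ℝ} (hs : 0 ≤ s) :
    Tendsto (fun n : ℕ => ((⌈s * n⌉₊ : ℕ) : ℝ) / n) atTop (𝓝 s) :=
  (tendsto_nat_ceil_mul_div_atTop hs).comp tendsto_natCast_atTop_atTop

theorem tendsto_natCast_div_floor {s : ℝ} (hs : 0 < s) :
    Tendsto (fun N : ℕ => (N : ℝ) / ((⌊s⁻¹ * N⌋₊ : ℕ) : ℝ)) atTop (𝓝 s) := by
  have h := ((tendsto_nat_floor_mul_div_atTop (R := ℝ) (inv_nonneg.2 hs.le)).comp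
    tendsto_natCast_atTop_atTop).inv₀ (inv_pos.2 hs).ne'
  simpa using h

theorem tendsto_floor_mul_natCast {s : ℝ} (hs : 0 < s) :
    Tendsto (fun N : ℕ => ⌊s * N⌋₊) atTop atTop :=
  tendsto_nat_floor_atTop.comp (tendsto_natCast_atTop_atTop.const_mul_atTop hs)

theorem tendsto_ceil_mul_natCast {s : ℝ} (hs : 0 < s) :
    Tendsto (fun N : ℕ => ⌈s * N⌉₊) atTop atTop :=
  tendsto_nat_ceil_atTop.comp (tendsto_natCast_atTop_atTop.const_mul_atTop hs)

/-- Frequently many `n` with `w_n > t n` yield frequently many `N = ⌈s n⌉`. -/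
theorem le_lamSup {ζ s t : ℝ} (hζ : Transcendental ℚ ζ) (hs : 1 ≤ s) (ht : 0 < t)
    (hst : s < 1 + t) (hw : (t : EReal) < wSup ζ) :
    ((s * (1 + t - s) / t : ℝ) : EReal) ≤ lamSup ζ := by
  have hs0 : 0 < s := by linarith
  refine EReal.ge_of_forall_gt_iff_ge.1 fun a ha => ?_
  have hev := eventually_le_natCast_mul_lam (n := fun n : ℕ => n) (N := fun n : ℕ => ⌈s * n⌉₊) hζ
    ht hst (EReal.coe_lt_coe_iff.1 ha) tendsto_id (tendsto_ceil_mul_natCast_div hs0.le)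
    (Eventually.of_forall fun n => by
      have h1 : (n : ℝ) ≤ s * n := le_mul_of_one_le_left (Nat.cast_nonneg n) hs
      exact_mod_cast h1.trans (Nat.le_ceil (s * n)))
  have hfreq := frequently_lt_of_lt_limsup (by isBoundedDefault) hw
  refine le_limsup_of_frequently_le' ?_
  exact (tendsto_ceil_mul_natCast hs0).frequently
    ((hfreq.and_eventually hev).mono fun n hn => hn.2 hn.1)

/-- If `w_n > t n` for all large `n`, every large `N` is served by `n = ⌊N / s⌋`. -/
theorem le_lamInf {ζ s t : ℝ} (hζ : Transcendental ℚ ζ) (hs : 1 ≤ s) (ht : 0 < t)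
    (hst : s < 1 + t) (hw : (t : EReal) < wInf ζ) :
    ((s * (1 + t - s) / t : ℝ) : EReal) ≤ lamInf ζ := by
  have hs0 : 0 < s := by linarith
  refine EReal.ge_of_forall_gt_iff_ge.1 fun a ha => ?_
  have htend := tendsto_floor_mul_natCast (inv_pos.2 hs0)
  have hev := eventually_le_natCast_mul_lam (n := fun N : ℕ => ⌊s⁻¹ * N⌋₊) (N := fun N : ℕ => N) hζ
    ht hst (EReal.coe_lt_coe_iff.1 ha) htend (tendsto_natCast_div_floor hs0)
    (Eventually.of_forall fun N => by
      have h1 : s⁻¹ * N ≤ (N : ℝ) :=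
        mul_le_of_le_one_left (Nat.cast_nonneg N) (inv_le_one_of_one_le₀ hs)
      have h2 : (0 : ℝ) ≤ s⁻¹ * N := by positivity
      exact_mod_cast (Nat.floor_le h2).trans h1)
  have hall := htend.eventually (eventually_lt_of_lt_liminf hw)
  refine le_liminf_of_le (by isBoundedDefault) ?_
  filter_upwards [hev, hall] with N h1 h2 using h1 h2

/-- The choice `s = (t + 1) / 2` is optimal in the transference lower bound. -/
theorem lowerBound_le {T L : EReal} (hT : 1 ≤ T)
    (h : ∀ s t : ℝ, 1 ≤ s → 0 < t → s < 1 + t → (t : EReal) < T →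
      ((s * (1 + t - s) / t : ℝ) : EReal) ≤ L) : lowerBound T ≤ L := by
  induction T with
  | bot => exact absurd (le_bot_iff.1 hT) (EReal.coe_ne_bot 1)
  | top =>
    rw [lowerBound, if_pos rfl, top_le_iff, EReal.eq_top_iff_forall_lt]
    intro y
    set t : ℝ := 1 + 4 * |y| with ht
    have hy := abs_nonneg y
    have h1 := h ((1 + t) / 2) t (by linarith) (by linarith) (by linarith) (EReal.coe_lt_top t)
    refine lt_of_lt_of_le ?_ h1
    rw [EReal.coe_lt_coe_iff, lt_div_iff₀ (by linarith)]
    have h2 := le_abs_self y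
    have h3 : y * t ≤ |y| * t := by gcongr
    nlinarith
  | coe t₀ =>
    have ht₀ : 1 ≤ t₀ := by exact_mod_cast hT
    have hlb : lowerBound (t₀ : EReal) = (((t₀ + 1) ^ 2 / (4 * t₀) : ℝ) : EReal) := by
      rw [lowerBound, if_neg (EReal.coe_ne_top t₀)]
      norm_cast
    rw [hlb]
    have hlim : Tendsto (fun t : ℝ => (((1 + t₀) / 2 * (1 + t - (1 + t₀) / 2) / t : ℝ) : EReal))
        (𝓝[<] t₀) (𝓝 (((t₀ + 1) ^ 2 / (4 * t₀) : ℝ) : EReal)) := by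
      refine (continuous_coe_real_ereal.tendsto _).comp (Tendsto.mono_left ?_ nhdsWithin_le_nhds)
      have hc : ContinuousAt (fun t : ℝ => (1 + t₀) / 2 * (1 + t - (1 + t₀) / 2) / t) t₀ := by
        refine ContinuousAt.div (by fun_prop) continuousAt_id (zero_lt_one.trans_le ht₀).ne'
      have he : (1 + t₀) / 2 * (1 + t₀ - (1 + t₀) / 2) / t₀ = (t₀ + 1) ^ 2 / (4 * t₀) := by
        field_simp
        ring
      rw [← he]
      exact hc
    refine le_of_tendsto hlim ?_
    have h1 : ∀ᶠ t in 𝓝[<] t₀, (t₀ - 1) / 2 < t :=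
      nhdsWithin_le_nhds (lt_mem_nhds (by linarith))
    filter_upwards [h1, self_mem_nhdsWithin] with t ht1 ht2
    exact h _ t (by linarith) (by linarith) (by linarith) (EReal.coe_lt_coe_iff.2 ht2)

/-- The transference upper bound along a sequence with `N / n → t + 2`. -/
theorem eventually_natCast_mul_lam_le {ι : Type*} {f : Filter ι} {n N : ι → ℕ} {ζ t a : ℝ}
    (hζ : Transcendental ℚ ζ) (ha : t + 2 < a) (hn : Tendsto n f atTop)
    (hN : Tendsto (fun i => (N i : ℝ) / n i) f (𝓝 (t + 2)))
    (hle : ∀ᶠ i in f, (t + 2) * n i ≤ N i) :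
    ∀ᶠ i in f, w (n i) ζ / (n i : EReal) < (t : EReal) → N i * lam (N i) ζ ≤ (a : EReal) := by
  filter_upwards [hn.eventually_ge_atTop 1, hN.eventually_lt_const ha, hle] with i hi1 hi2 hi3 hiw
  have h := lam_le_one_div hζ hi1 ((w_div_lt_coe_iff hi1).1 hiw) (N := N i) (by linarith)
  refine (natCast_mul_le_natCast_mul _ h).trans ?_
  rw [natCast_mul_coe, EReal.coe_le_coe_iff, mul_one_div]
  exact hi2.le

/-- If `w_n < t n` for all large `n`, every large `N` is served by `n = ⌊N / (t + 2)⌋`. -/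
theorem lamSup_le {ζ t : ℝ} (hζ : Transcendental ℚ ζ) (hw : wSup ζ < (t : EReal)) :
    lamSup ζ ≤ ((t + 2 : ℝ) : EReal) := by
  have ht1 : 1 < t := by exact_mod_cast (one_le_wSup hζ).trans_lt hw
  have ht2 : 0 < t + 2 := by linarith
  refine EReal.le_of_forall_lt_iff_le.1 fun a ha => ?_
  have htend := tendsto_floor_mul_natCast (inv_pos.2 ht2)
  have hev := eventually_natCast_mul_lam_le (n := fun N : ℕ => ⌊(t + 2)⁻¹ * N⌋₊)
    (N := fun N : ℕ => N) hζ (EReal.coe_lt_coe_iff.1 ha) htend (tendsto_natCast_div_floor ht2)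
    (Eventually.of_forall fun N => by
      have h2 : (0 : ℝ) ≤ (t + 2)⁻¹ * N := by positivity
      have h3 := Nat.floor_le h2
      rwa [inv_mul_eq_div, le_div_iff₀ ht2, mul_comm, ← inv_mul_eq_div] at h3)
  have hall := htend.eventually (eventually_lt_of_limsup_lt hw)
  refine limsup_le_of_le (by isBoundedDefault) ?_
  filter_upwards [hev, hall] with N h1 h2 using h1 h2

/-- Frequently many `n` with `w_n < t n` yield frequently many `N = ⌈(t + 2) n⌉`. -/
theorem lamInf_le {ζ t : ℝ} (hζ : Transcendental ℚ ζ) (hw : wInf ζ < (t : EReal)) :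
    lamInf ζ ≤ ((t + 2 : ℝ) : EReal) := by
  have ht1 : 1 < t := by exact_mod_cast (one_le_wInf hζ).trans_lt hw
  have ht2 : 0 < t + 2 := by linarith
  refine EReal.le_of_forall_lt_iff_le.1 fun a ha => ?_
  have hev := eventually_natCast_mul_lam_le (n := fun n : ℕ => n)
    (N := fun n : ℕ => ⌈(t + 2) * n⌉₊) hζ (EReal.coe_lt_coe_iff.1 ha) tendsto_id
    (tendsto_ceil_mul_natCast_div ht2.le) (Eventually.of_forall fun n => Nat.le_ceil _)
  have hfreq := frequently_lt_of_liminf_lt (by isBoundedDefault) hw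
  refine liminf_le_of_frequently_le' ?_
  exact (tendsto_ceil_mul_natCast ht2).frequently
    ((hfreq.and_eventually hev).mono fun n hn => hn.2 hn.1)

theorem le_add_two {T L : EReal} (hT : 1 ≤ T)
    (h : ∀ t : ℝ, T < (t : EReal) → L ≤ ((t + 2 : ℝ) : EReal)) : L ≤ T + 2 := by
  refine EReal.le_of_forall_lt_iff_le.1 fun z hz => ?_
  induction T with
  | bot => exact absurd (le_bot_iff.1 hT) (EReal.coe_ne_bot 1)
  | top => simp [EReal.top_add_of_ne_bot (show (2 : EReal) ≠ ⊥ by decide)] at hz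
  | coe t₀ =>
    have hz' : t₀ + 2 < z := by
      rw [← EReal.coe_lt_coe_iff, EReal.coe_add]
      exact hz
    have := h (z - 2) (EReal.coe_lt_coe_iff.2 (by linarith))
    simpa using this

/-! ### Orders -/

theorem elog_coe {x : ℝ} (hx : 0 < x) : elog (x : EReal) = (Real.log x : EReal) := by
  rw [elog, EReal.real_coe_toENNReal, ENNReal.log_ofReal_of_pos hx]

theorem elog_mono : Monotone elog := fun _ _ h =>
  ENNReal.log_monotone (EReal.toENNReal_le_toENNReal h)

theorem log_natCast_pos {n : ℕ} (hn : 2 ≤ n) : 0 < Real.log n :=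
  Real.log_pos (by exact_mod_cast hn)

theorem tendsto_log_natCast : Tendsto (fun n : ℕ => Real.log n) atTop atTop :=
  Real.tendsto_log_atTop.comp tendsto_natCast_atTop_atTop

theorem elog_div_log_le {n : ℕ} (hn : 2 ≤ n) {x : EReal} {y : ℝ} (hy : 0 < y)
    (h : x ≤ (y : EReal)) :
    elog x / (Real.log n : EReal) ≤ ((Real.log y / Real.log n : ℝ) : EReal) := by
  rw [EReal.coe_div, ← elog_coe hy]
  exact EReal.div_le_div_right_of_nonneg (by exact_mod_cast (log_natCast_pos hn).le) (elog_mono h)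

theorem le_elog_div_log {n : ℕ} (hn : 2 ≤ n) {x : EReal} {y : ℝ} (hy : 0 < y)
    (h : (y : EReal) ≤ x) :
    ((Real.log y / Real.log n : ℝ) : EReal) ≤ elog x / (Real.log n : EReal) := by
  rw [EReal.coe_div, ← elog_coe hy]
  exact EReal.div_le_div_right_of_nonneg (by exact_mod_cast (log_natCast_pos hn).le) (elog_mono h)

theorem lt_rpow_of_elog_div_log_lt {n : ℕ} (hn : 2 ≤ n) {x : EReal} {u : ℝ}
    (h : elog x / (Real.log n : EReal) < (u : EReal)) : x < (((n : ℝ) ^ u : ℝ) : EReal) := by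
  have hn0 : (0 : ℝ) < n := by positivity
  by_contra! hcon
  have h1 := (le_elog_div_log hn (by positivity) hcon).trans_lt h
  rw [Real.log_rpow hn0, mul_div_cancel_right₀ _ (log_natCast_pos hn).ne'] at h1
  exact lt_irrefl _ h1

theorem rpow_lt_of_lt_elog_div_log {n : ℕ} (hn : 2 ≤ n) {x : EReal} {u : ℝ}
    (h : (u : EReal) < elog x / (Real.log n : EReal)) : (((n : ℝ) ^ u : ℝ) : EReal) < x := by
  have hn0 : (0 : ℝ) < n := by positivity
  by_contra! hcon
  have h1 := h.trans_le (elog_div_log_le hn (by positivity) hcon)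
  rw [Real.log_rpow hn0, mul_div_cancel_right₀ _ (log_natCast_pos hn).ne'] at h1
  exact lt_irrefl _ h1

theorem one_le_tau {ζ : ℝ} (hζ : Transcendental ℚ ζ) : 1 ≤ tau ζ := by
  refine le_limsup_of_frequently_le' (Eventually.frequently ?_)
  filter_upwards [eventually_ge_atTop 2] with n hn
  have h := le_elog_div_log hn (x := w n ζ) (y := n) (by positivity)
    (by rw [EReal.coe_coe_eq_natCast]; exact le_w hζ (by omega))
  rwa [div_self (log_natCast_pos hn).ne', EReal.coe_one] at h

theorem sigma_le_of_tau_lt {ζ u : ℝ} (hζ : Transcendental ℚ ζ) (hu : tau ζ < (u : EReal)) :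
    sigma ζ ≤ ((-(1 / u) : ℝ) : EReal) := by
  have hu1 : 1 < u := by exact_mod_cast (one_le_tau hζ).trans_lt hu
  have hu0 : 0 < u := by linarith
  refine EReal.le_of_forall_lt_iff_le.1 fun a ha => ?_
  have ha' : -(1 / u) < a := EReal.coe_lt_coe_iff.1 ha
  -- With `n = ⌊(N / 4) ^ (1 / u)⌋` one has `2 n - 1 + n ^ u ≤ 3 n ^ u ≤ N`.
  set x : ℕ → ℝ := fun N => ((N : ℝ) / 4) ^ (1 / u) with hx
  have hxt : Tendsto x atTop atTop := (tendsto_rpow_atTop (one_div_pos.2 hu0)).comp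
    (tendsto_natCast_atTop_atTop.atTop_div_const (by norm_num))
  have hn : Tendsto (fun N => ⌊x N⌋₊) atTop atTop := tendsto_nat_floor_atTop.comp hxt
  have hlim : Tendsto (fun N : ℕ => -(1 / u) + (Real.log 4 / u + Real.log 2) / Real.log N) atTop
      (𝓝 (-(1 / u))) := by
    have := (tendsto_log_natCast.const_div_atTop (Real.log 4 / u + Real.log 2)).const_add (-(1 / u))
    rwa [add_zero] at this
  refine limsup_le_of_le (by isBoundedDefault) ?_
  filter_upwards [hn.eventually_ge_atTop 2, hn.eventually (eventually_lt_of_limsup_lt hu),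
    eventually_ge_atTop 2, hlim.eventually_lt_const ha'] with N h1 h2 h3 h4
  set n := ⌊x N⌋₊ with hndef
  have hw := lt_rpow_of_elog_div_log_lt h1 h2
  have hN0 : (0 : ℝ) < N := by positivity
  have hx0 : 0 ≤ x N := by positivity
  have hnx : (n : ℝ) ≤ x N := Nat.floor_le hx0
  have hn2 : (2 : ℝ) ≤ n := by exact_mod_cast h1
  have hnu : (n : ℝ) ^ u ≤ N / 4 := by
    calc (n : ℝ) ^ u ≤ (x N) ^ u := Real.rpow_le_rpow (by linarith) hnx hu0.le
      _ = N / 4 := by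
        rw [hx, ← Real.rpow_mul (by positivity), one_div_mul_cancel hu0.ne', Real.rpow_one]
  have hnn : (n : ℝ) ≤ (n : ℝ) ^ u := by
    nth_rewrite 1 [← Real.rpow_one (n : ℝ)]
    exact Real.rpow_le_rpow_of_exponent_le (by linarith) hu1.le
  have hlam := lam_le_one_div hζ (by omega) hw (N := N) (by linarith)
  have hL : 0 < Real.log N := log_natCast_pos h3
  refine (elog_div_log_le h3 (by positivity) hlam).trans ?_
  rw [EReal.coe_le_coe_iff]
  refine le_trans ?_ h4.le
  have hlogn : (Real.log N - Real.log 4) / u - Real.log 2 ≤ Real.log n := by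
    have h5 : x N / 2 ≤ n := by
      have := Nat.lt_floor_add_one (x N)
      rw [← hndef] at this
      linarith
    have hxpos : 0 < x N := by positivity
    have h6 := Real.log_le_log (by positivity) h5
    rw [Real.log_div hxpos.ne' two_ne_zero, hx, Real.log_rpow (by positivity),
      Real.log_div hN0.ne' (by norm_num)] at h6
    refine le_trans (le_of_eq ?_) h6
    ring
  rw [one_div, Real.log_inv, div_le_iff₀ hL, add_mul, div_mul_cancel₀ _ hL.ne']
  have h7 : (Real.log N - Real.log 4) / u = 1 / u * Real.log N - Real.log 4 / u := by ring
  rw [h7] at hlogn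
  rw [one_div] at hlogn ⊢
  linarith

theorem lam_le_lam_one {N : ℕ} (hN : 1 ≤ N) (ζ : ℝ) : lam N ζ ≤ lam 1 ζ := by
  refine iSup_mono fun l => iSup_mono' fun h => ⟨h.mono ?_, le_rfl⟩
  rintro X ⟨x, y, h1, h2, h3⟩
  refine ⟨x, fun _ => y ⟨0, hN⟩, h1, h2, fun i => ?_⟩
  have hi : (i : ℕ) = 0 := by omega
  simpa [hi] using h3 ⟨0, hN⟩

/-- A number that is not a Liouville number has finite `λ_1`. -/
theorem lam_one_lt_top {ζ : ℝ} (hζ : Transcendental ℚ ζ) (h : ¬ Liouville ζ) : lam 1 ζ < ⊤ := by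
  by_contra htop
  rw [not_lt_top_iff] at htop
  refine h fun n => ?_
  have hlt : ((2 * n + 1 : ℝ) : EReal) < lam 1 ζ := by rw [htop]; exact EReal.coe_lt_top _
  simp only [lam, lt_iSup_iff] at hlt
  obtain ⟨l, hfreq, hl⟩ := hlt
  have hl' : (2 * n + 1 : ℝ) < l := by exact_mod_cast hl
  obtain ⟨X, ⟨x, y, hx1, hxX, hxy⟩, hX⟩ := (hfreq.and_eventually (eventually_gt_atTop 2)).exists
  have hx0 : x ≠ 0 := by rintro rfl; simp at hx1
  have hX0 : 0 < X := by linarith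
  have hxX' : |(x : ℝ)| ≤ X := by exact_mod_cast hxX
  have hx1' : 1 ≤ |(x : ℝ)| := by exact_mod_cast hx1
  have h0 := hxy 0
  simp only [Fin.val_zero, zero_add, pow_one] at h0
  -- Doubling the denominator avoids the value `1`.
  have habs : ((2 * |x| : ℤ) : ℝ) = 2 * |(x : ℝ)| := by push_cast; ring
  have hfrac : ((x.sign * (2 * y 0) : ℤ) : ℝ) / ((2 * |x| : ℤ) : ℝ) = y 0 / x := by
    have hs : (x : ℝ) = (x.sign : ℝ) * |(x : ℝ)| := by
      exact_mod_cast (Int.sign_mul_abs x).symm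
    have hs2 : (x.sign : ℝ) * (x.sign : ℝ) = 1 := by
      rcases lt_or_gt_of_ne hx0 with hneg | hpos
      · simp [Int.sign_eq_neg_one_of_neg hneg]
      · simp [Int.sign_eq_one_of_pos hpos]
    have hxr : (x : ℝ) ≠ 0 := by exact_mod_cast hx0
    rw [habs, div_eq_div_iff (by positivity) hxr]
    push_cast
    calc (x.sign : ℝ) * (2 * y 0) * x = 2 * y 0 * ((x.sign : ℝ) * x) := by ring
      _ = 2 * y 0 * ((x.sign : ℝ) * ((x.sign : ℝ) * |(x : ℝ)|)) := by rw [← hs]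
      _ = 2 * y 0 * (((x.sign : ℝ) * (x.sign : ℝ)) * |(x : ℝ)|) := by ring
      _ = y 0 * (2 * |(x : ℝ)|) := by rw [hs2]; ring
  refine ⟨x.sign * (2 * y 0), 2 * |x|, by omega, ?_, ?_⟩
  · rw [hfrac]
    intro heq
    refine hζ ?_
    rw [heq]
    have : ((y 0 : ℝ) / x) = algebraMap ℚ ℝ ((y 0 : ℚ) / x) := by simp
    rw [this]
    exact isAlgebraic_algebraMap _
  · rw [hfrac, habs]
    have hxr : (x : ℝ) ≠ 0 := by exact_mod_cast hx0
    have h1 : |ζ - y 0 / x| = |ζ * x - y 0| / |(x : ℝ)| := by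
      rw [← abs_div, sub_div, mul_div_cancel_right₀ _ hxr]
    have h2 : |ζ - y 0 / x| ≤ X ^ (-l) := by
      rw [h1]
      exact (div_le_self (abs_nonneg _) hx1').trans h0
    refine h2.trans_lt ?_
    have h3 : (2 * |(x : ℝ)|) ^ n ≤ X ^ ((2 * n : ℕ) : ℝ) := by
      rw [Real.rpow_natCast, pow_mul]
      gcongr
      nlinarith
    have h4 : X ^ ((2 * n : ℕ) : ℝ) < X ^ l := by
      refine Real.rpow_lt_rpow_of_exponent_lt (by linarith) ?_
      push_cast
      linarith
    rw [Real.rpow_neg hX0.le, ← one_div]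
    exact one_div_lt_one_div_of_lt (by positivity) (h3.trans_lt h4)

theorem sigma_le_zero {ζ : ℝ} (hζ : Transcendental ℚ ζ) (h : ¬ Liouville ζ) : sigma ζ ≤ 0 := by
  obtain ⟨c, hc, -⟩ := EReal.exists_between_coe_real (lam_one_lt_top hζ h)
  have hc1 : lam 1 ζ ≤ ((max c 1 : ℝ) : EReal) :=
    hc.le.trans (EReal.coe_le_coe_iff.2 (le_max_left _ _))
  refine EReal.le_of_forall_lt_iff_le.1 fun a ha => ?_
  have ha' : 0 < a := by exact_mod_cast ha
  have hlim := tendsto_log_natCast.const_div_atTop (Real.log (max c 1))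
  refine limsup_le_of_le (by isBoundedDefault) ?_
  filter_upwards [eventually_ge_atTop 2, hlim.eventually_lt_const ha'] with N h2 h3
  refine (elog_div_log_le h2 (by positivity)
    ((lam_le_lam_one (by omega) ζ).trans hc1)).trans ?_
  exact EReal.coe_le_coe_iff.2 h3.le

/-- Follows from `λ_N ≥ 1 / (2 N)`; needed separately because `le_sigma_of_lt_tau` says nothing when
`τ = 1`. -/
theorem neg_one_le_sigma {ζ : ℝ} (hζ : Transcendental ℚ ζ) : ((-1 : ℝ) : EReal) ≤ sigma ζ := by
  refine EReal.ge_of_forall_gt_iff_ge.1 fun a ha => ?_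
  have ha' : a < -1 := EReal.coe_lt_coe_iff.1 ha
  have hlim : Tendsto (fun N : ℕ => -1 + -Real.log 2 / Real.log N) atTop (𝓝 (-1)) := by
    have := (tendsto_log_natCast.const_div_atTop (-Real.log 2)).const_add (-1)
    rwa [add_zero] at this
  refine le_limsup_of_frequently_le' (Eventually.frequently ?_)
  filter_upwards [eventually_ge_atTop 2, hlim.eventually_const_lt ha'] with N h2 h3
  have hN : (2 : ℝ) ≤ N := by exact_mod_cast h2
  have hw : ((N / 2 : ℝ) : EReal) < w N ζ := by
    refine lt_of_lt_of_le ?_ (le_w hζ (by omega))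
    rw [← EReal.coe_coe_eq_natCast, EReal.coe_lt_coe_iff]
    linarith
  have hlam := le_lam_of_lt_w hζ (by omega) le_rfl (by linarith) hw
  have hval : ((2 * N : ℝ))⁻¹ ≤ (N + N / 2 - N) / ((N - 1) * (N / 2) + N) := by
    have hd : (0 : ℝ) < (N - 1) * (N / 2) + N := by nlinarith
    rw [le_div_iff₀ hd, inv_mul_le_iff₀ (by positivity)]
    nlinarith
  have hL : 0 < Real.log N := log_natCast_pos h2
  refine le_trans ?_ (le_elog_div_log h2 (y := ((2 * N : ℝ))⁻¹) (by positivity)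
    ((EReal.coe_le_coe_iff.2 hval).trans hlam))
  rw [EReal.coe_le_coe_iff, Real.log_inv, Real.log_mul two_ne_zero (by positivity)]
  refine h3.le.trans (le_of_eq ?_)
  field_simp
  ring

/-- With `W = n ^ t < w_n` and `N = ⌊W / 2⌋`, the transference lower bound is at least
`1 / (2 n)`. -/
theorem le_sigma_of_lt_tau {ζ t : ℝ} (hζ : Transcendental ℚ ζ) (ht : 1 < t)
    (htau : (t : EReal) < tau ζ) : ((-(1 / t) : ℝ) : EReal) ≤ sigma ζ := by
  have ht0 : 0 < t := by linarith
  refine EReal.ge_of_forall_gt_iff_ge.1 fun a ha => ?_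
  have ha' : a < -(1 / t) := EReal.coe_lt_coe_iff.1 ha
  have hpow : Tendsto (fun n : ℕ => (n : ℝ) ^ t / 2) atTop atTop :=
    ((tendsto_rpow_atTop ht0).comp tendsto_natCast_atTop_atTop).atTop_div_const two_pos
  have hN : Tendsto (fun n : ℕ => ⌊(n : ℝ) ^ t / 2⌋₊) atTop atTop :=
    tendsto_nat_floor_atTop.comp hpow
  have hlim : Tendsto (fun n : ℕ => -((Real.log 2 / Real.log n + 1) /
      (t - Real.log 4 / Real.log n))) atTop (𝓝 (-(1 / t))) := by
    have h1 := (((tendsto_log_natCast.const_div_atTop (Real.log 2)).add_const 1).div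
      ((tendsto_log_natCast.const_div_atTop (Real.log 4)).const_sub t) (by simpa using ht0.ne')).neg
    simp only [zero_add, sub_zero] at h1
    exact h1
  have hgt : ∀ᶠ n : ℕ in atTop, (2 : ℝ) ≤ (n : ℝ) ^ (t - 1) :=
    ((tendsto_rpow_atTop (sub_pos.2 ht)).comp
      tendsto_natCast_atTop_atTop).eventually_ge_atTop 2
  have hlog : ∀ᶠ n : ℕ in atTop, Real.log 4 < t * Real.log n :=
    (tendsto_log_natCast.const_mul_atTop ht0).eventually_gt_atTop _
  have hev : ∀ᶠ n : ℕ in atTop, (t : EReal) < elog (w n ζ) / (Real.log n : EReal) →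
      (a : EReal) ≤ elog (lam ⌊(n : ℝ) ^ t / 2⌋₊ ζ) /
        (Real.log (⌊(n : ℝ) ^ t / 2⌋₊ : ℕ) : EReal) := by
    filter_upwards [eventually_ge_atTop 2, hgt, hlog, hlim.eventually_const_lt ha']
      with n h1 h2 h3 h4 h5
    have hw := rpow_lt_of_lt_elog_div_log h1 h5
    have hn2 : (2 : ℝ) ≤ n := by exact_mod_cast h1
    have hn0 : (0 : ℝ) < n := by linarith
    set W : ℝ := (n : ℝ) ^ t with hW
    have hWn : 2 * (n : ℝ) ≤ W := by
      have : W = (n : ℝ) ^ (t - 1) * n := by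
        rw [hW, ← Real.rpow_add_one hn0.ne', sub_add_cancel]
      rw [this]
      gcongr
    set N := ⌊W / 2⌋₊ with hNdef
    have hNW : (N : ℝ) ≤ W / 2 := Nat.floor_le (by linarith)
    have hnN : n ≤ N := Nat.le_floor (by linarith)
    have hNW' : W / 4 ≤ N := by
      have := Nat.lt_floor_add_one (W / 2)
      rw [← hNdef] at this
      linarith
    have hlam := le_lam_of_lt_w hζ (by omega) hnN (by linarith) hw
    have hval : ((2 * n : ℝ))⁻¹ ≤ (n + W - N) / ((n - 1) * W + N) := by
      have hd : (0 : ℝ) < (n - 1) * W + N := by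
        have h6 : 0 ≤ ((n : ℝ) - 1) * W := mul_nonneg (by linarith) (by linarith)
        have h7 : (0 : ℝ) < N := by linarith
        linarith
      rw [le_div_iff₀ hd, inv_mul_le_iff₀ (by positivity)]
      have h6 : (n : ℝ) * N ≤ n * (W / 2) := by gcongr
      nlinarith
    have hN2 : 2 ≤ N := h1.trans hnN
    refine le_trans ?_ (le_elog_div_log hN2 (y := ((2 * n : ℝ))⁻¹) (by positivity)
      ((EReal.coe_le_coe_iff.2 hval).trans hlam))
    rw [EReal.coe_le_coe_iff, Real.log_inv, Real.log_mul two_ne_zero hn0.ne', neg_div]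
    refine h4.le.trans (neg_le_neg ?_)
    have hLn : 0 < Real.log n := log_natCast_pos h1
    have hlogN : t * Real.log n - Real.log 4 ≤ Real.log N := by
      have h6 := Real.log_le_log (by linarith) hNW'
      rwa [Real.log_div (by linarith) (by norm_num), hW, Real.log_rpow hn0] at h6
    have hl2 : 0 < Real.log 2 := Real.log_pos (by norm_num)
    calc (Real.log 2 + Real.log n) / Real.log N
        ≤ (Real.log 2 + Real.log n) / (t * Real.log n - Real.log 4) := by
          gcongr
      _ = (Real.log 2 / Real.log n + 1) / (t - Real.log 4 / Real.log n) := by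
          have h6 : Real.log 2 / Real.log n + 1 = (Real.log 2 + Real.log n) / Real.log n := by
            field_simp
          have h7 : t - Real.log 4 / Real.log n =
              (t * Real.log n - Real.log 4) / Real.log n := by
            field_simp
          rw [h6, h7, div_div_div_cancel_right₀ hLn.ne']
  have hfreq := frequently_lt_of_lt_limsup (by isBoundedDefault) htau
  refine le_limsup_of_frequently_le' ?_
  exact hN.frequently ((hfreq.and_eventually hev).mono fun n hn => hn.2 hn.1)

theorem sigma_eq_neg_one_div_tau {ζ : ℝ} (hζ : Transcendental ℚ ζ) (h : ¬ Liouville ζ) :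
    sigma ζ = -(1 / tau ζ) := by
  have h1 := one_le_tau hζ
  have hup := fun u : ℝ => sigma_le_of_tau_lt (u := u) hζ
  have hlo := fun t : ℝ => le_sigma_of_lt_tau (t := t) hζ
  generalize tau ζ = T at h1 hup hlo ⊢
  induction T with
  | bot => exact absurd (le_bot_iff.1 h1) (EReal.coe_ne_bot 1)
  | top =>
    rw [EReal.div_top, neg_zero]
    refine le_antisymm (sigma_le_zero hζ h) (EReal.ge_of_forall_gt_iff_ge.1 fun a ha => ?_)
    have ha' : a < 0 := by exact_mod_cast ha
    have h2 : 1 < 1 + -a⁻¹ := by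
      have := inv_lt_zero.2 ha'
      linarith
    refine le_trans ?_ (hlo (1 + -a⁻¹) h2 (EReal.coe_lt_top _))
    rw [EReal.coe_le_coe_iff, le_neg, one_div]
    have h3 : 0 < -a⁻¹ := by linarith
    calc (1 + -a⁻¹)⁻¹ ≤ (-a⁻¹)⁻¹ := inv_anti₀ h3 (by linarith)
      _ = -a := by rw [inv_neg, inv_inv]
  | coe t₀ =>
    have ht₀ : 1 ≤ t₀ := by exact_mod_cast h1
    have he : -(1 / (t₀ : EReal)) = ((-(1 / t₀) : ℝ) : EReal) := by
      rw [EReal.coe_neg, EReal.coe_div, EReal.coe_one]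
    have hc : Tendsto (fun u : ℝ => ((-(1 / u) : ℝ) : EReal)) (𝓝 t₀)
        (𝓝 ((-(1 / t₀) : ℝ) : EReal)) := by
      refine (continuous_coe_real_ereal.tendsto _).comp ?_
      exact (continuousAt_const.div continuousAt_id (zero_lt_one.trans_le ht₀).ne').neg
    rw [he]
    refine le_antisymm ?_ ?_
    · refine ge_of_tendsto (hc.mono_left (nhdsWithin_le_nhds (s := Set.Ioi t₀))) ?_
      filter_upwards [self_mem_nhdsWithin] with u hu
      exact hup u (EReal.coe_lt_coe_iff.2 hu)
    · rcases ht₀.eq_or_lt with rfl | hlt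
      · simpa using neg_one_le_sigma hζ
      · refine le_of_tendsto (hc.mono_left (nhdsWithin_le_nhds (s := Set.Iio t₀))) ?_
        filter_upwards [self_mem_nhdsWithin,
          nhdsWithin_le_nhds (lt_mem_nhds hlt)] with t ht1 ht2
        exact hlo t ht2 (EReal.coe_lt_coe_iff.2 ht1)

end Limits

end MahlerExp

theorem theorem2p3 (ζ : ℝ) (hζ : Transcendental ℚ ζ) :
    (MahlerExp.lowerBound (MahlerExp.wSup ζ) ≤ MahlerExp.lamSup ζ ∧
      MahlerExp.lamSup ζ ≤ MahlerExp.wSup ζ + 2) ∧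
    (MahlerExp.lowerBound (MahlerExp.wInf ζ) ≤ MahlerExp.lamInf ζ ∧
      MahlerExp.lamInf ζ ≤ MahlerExp.wInf ζ + 2) ∧
    (¬ Liouville ζ → MahlerExp.sigma ζ = -(1 / MahlerExp.tau ζ)) :=
  ⟨⟨MahlerExp.lowerBound_le (MahlerExp.one_le_wSup hζ) fun _ _ => MahlerExp.le_lamSup hζ,
      MahlerExp.le_add_two (MahlerExp.one_le_wSup hζ) fun _ => MahlerExp.lamSup_le hζ⟩,
    ⟨MahlerExp.lowerBound_le (MahlerExp.one_le_wInf hζ) fun _ _ => MahlerExp.le_lamInf hζ,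
      MahlerExp.le_add_two (MahlerExp.one_le_wInf hζ) fun _ => MahlerExp.lamInf_le hζ⟩,
    MahlerExp.sigma_eq_neg_one_div_tau hζ⟩
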